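/- **Theorem.** There is an absolute constant $C>0$ such that the following holds for every dimension $d\ge 1$, every unitary $U\in\mathbb C^{d\times d}$ and every integer $n\ge 1$. Let $\hat U$ be the estimate of $U$ produced by the algorithm below, with $n$ copies for each measurement setting, and let $N=(3d-2)(2d-1)\,n$ be the total number of copies of probe states. Then $$\mathbb E\,\|\hat U-U\|\;\le\; C\,\frac{d^{2.5}}{\sqrt N},$$ where $\|\cdot\|$ is the Hilbert–Schmidt norm and $\mathbb E$ is the expectation over the measurement outcomes, which are independent given the settings and follow the Born rule. Ties in the maximizations and the choice of a singular value decomposition may be resolved in any way. *Probe states.* The $3d-2$ pure states with vectors $|k\rangle$ ($1\le k\le d$), $|+_k\rangle=(|1\rangle+|k\rangle)/\sqrt2$ and $|-_k\rangle=(|1\rangle+i|k\rangle)/\sqrt2$ ($2\le k\le d$) are sent through the gate. Each output state is reconstructed separately, with $2d-1$ POVMs and $n$ copies for each of them. *Tomography of a pure output state $\rho$.* Measure $n$ copies in the basis $\{|j\rangle\langle j|\}$, let $\hat\rho_{jj}$ be the relative frequencies and let $s$ be an index for which $\hat\rho_{ss}$ is largest. For each $j\ne s$ measure $n$ copies with the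 POVM $\{P_j,I-P_j\}$ and $n$ copies with $\{Q_j,I-Q_j\}$, where $P_j=\frac12(|s\rangle+|j\rangle)(\langle s|+\langle j|)$ and $Q_j=\frac12(|s\rangle+i|j\rangle)(\langle s|-i\langle j|)$; let $\hat\rho^{+}_{js}$, $\hat\rho^{-}_{js}$ be the relative frequencies of the outcomes $P_j$, $Q_j$. Put $\hat\rho_{js}=\hat\rho^{+}_{js}+i\hat\rho^{-}_{js}-\frac{1+i}2\hat\rho_{ss}-\frac{1+i}2\hat\rho_{jj}$ for $j\neq s$, let $c=(\hat\rho_{js})_{j}$ (with $s$-th entry $\hat\rho_{ss}$), and let $\hat\rho=cc^\dagger/\mathrm{Tr}(cc^\dagger)$. *Reconstruction of the gate.* Let $\varepsilon(\rho)=U\rho U^\dagger$. The estimates of the output states give $\hat\varepsilon(|1\rangle\langle1|)$ and, for $k\ge2$, $$\hat\varepsilon(|1\rangle\langle k|)=\hat\varepsilon(|+_k\rangle\langle+_k|)+i\,\hat\varepsilon(|-_k\rangle\langle-_k|)-\tfrac{1+i}2\hat\varepsilon(|1\rangle\langle1|)-\tfrac{1+i}2\hat\varepsilon(|k\rangle\langle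 k|).$$ Take the natural basis $|j\rangle\langle k|$ of $\mathbb C^{d\times d}$, numbered by $(j-1)d+k$, both as Kraus basis $\{E_i\}$ and as input basis $\{\rho_m\}$. Define $B_{mn,jk}$ by $E_j\rho_mE_k^\dagger=\sum_nB_{mn,jk}\rho_n$ and $\hat\lambda_{mn}$ by $\hat\varepsilon(\rho_m)=\sum_n\hat\lambda_{mn}\rho_n$, and let $\hat D_{jk}=\sum_{m,n}B_{mn,jk}\hat\lambda_{mn}$. Only the rows of $\hat D$ with numbers $(a-1)d+1$, $1\le a\le d$, are used; they involve only the estimates above. Let $j$ be a value of $a$ for which this row has the largest Euclidean norm, let $\hat S$ be the $d\times d$ matrix for which $\mathrm{vec}(\hat S)$ (columns stacked) is the adjoint of the row of number $(j-1)d+1$, and let $\hat G=\hat U_1\hat U_2$ for a singular value decomposition $\hat S=\hat U_1\hat\Sigma\hat U_2$. Finally $\hat U=e^{i\theta}\hat G^{T}$, where the global phase is calibrated by prior knowledge of the phase $\theta=\arg U_{j1}$ of the entry $U_{j1}$ of the gate ($\theta=0$ if $U_{j1}=0$). -/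

import Mathlib

open scoped Matrix Matrix.Norms.Frobenius

noncomputable section

namespace GateIdent

/-! Notation: the basis vectors `|1⟩, …, |d⟩` are indexed by `Fin d`, so that the index `1` of
the usual notation is `0 : Fin d`. With `Matrix.Norms.Frobenius` open, `‖A‖` is the Hilbert-Schmidt norm of `A`. -/

/-- `d × d` complex matrices. -/
abbrev Mat (d : ℕ) : Type := Matrix (Fin d) (Fin d) ℂ

/-- The ket `|j⟩`. -/
def ket {d : ℕ} (j : Fin d) : Fin d → ℂ := Pi.single j 1

/-- The operator `|v⟩⟨v|`. -/
def proj {d : ℕ} (v : Fin d → ℂ) : Mat d := Matrix.vecMulVec v (star v)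

/-! ### Measurements -/

/-- Born rule: the probability `Tr(ρ P)` of the outcome with POVM element `P` in the state `ρ`. -/
def born {d : ℕ} (ρ P : Mat d) : ℝ := (Matrix.trace (ρ * P)).re

/-- The probability of observing the sequence of outcomes `a` when `n` copies of the state `ρ` are
measured, one after the other and independently, with the POVM `P`. -/
def seqProb {d n : ℕ} {α : Type} (ρ : Mat d) (P : α → Mat d) (a : Fin n → α) : ℝ :=
  ∏ i, born ρ (P (a i))

/-- The relative frequency of the outcome `x` in the sequence `a`. -/
def freq {n : ℕ} {α : Type} [DecidableEq α] (a : Fin n → α) (x : α) : ℝ :=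
  ((Finset.univ.filter fun i => a i = x).card : ℝ) / n

/-- The measurement in the basis `|j⟩⟨j|`. -/
def basisPOVM (d : ℕ) : Fin d → Mat d := fun j => proj (ket j)

/-- `P_j = (|s⟩ + |j⟩)(⟨s| + ⟨j|) / 2`. -/
def effP {d : ℕ} (s j : Fin d) : Mat d := (1 / 2 : ℂ) • proj (ket s + ket j)

/-- `Q_j = (|s⟩ + i|j⟩)(⟨s| - i⟨j|) / 2`. -/
def effQ {d : ℕ} (s j : Fin d) : Mat d := (1 / 2 : ℂ) • proj (ket s + Complex.I • ket j)

/-- The two-outcome POVM `{P, I - P}`. -/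
def yesNo {d : ℕ} (P : Mat d) : Bool → Mat d := fun b => if b then P else 1 - P

/-! ### Fast tomography of a pure state -/

/-- What is recorded in the tomography of one state, with `n` copies per POVM: first `n` outcomes
of the basis measurement; they determine the index `s`, by the rule `sel` applied to the vector of
relative frequencies; then, for every `j ≠ s`, `n` outcomes of `{P_j, I - P_j}` and `n` outcomes of
`{Q_j, I - Q_j}`. -/
abbrev StateRecord (d n : ℕ) (sel : (Fin d → ℝ) → Fin d) : Type :=
  (a : Fin n → Fin d) × ({j : Fin d // j ≠ sel (freq a)} → (Fin n → Bool) × (Fin n → Bool))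

/-- The probability of the record `r` when the state is `ρ`. -/
def stateProb {d n : ℕ} {sel : (Fin d → ℝ) → Fin d} (ρ : Mat d) (r : StateRecord d n sel) : ℝ :=
  seqProb ρ (basisPOVM d) r.1 *
    ∏ j : {j : Fin d // j ≠ sel (freq r.1)},
      (seqProb ρ (yesNo (effP (sel (freq r.1)) j.1)) (r.2 j).1 *
        seqProb ρ (yesNo (effQ (sel (freq r.1)) j.1)) (r.2 j).2)

/-- The estimate of the `s`-th column of the state: its `s`-th entry is `ρ̂_{ss}` and for `j ≠ s`
its `j`-th entry is `ρ̂⁺_{js} + i ρ̂⁻_{js} - (1+i)/2 ρ̂_{ss} - (1+i)/2 ρ̂_{jj}`. -/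
def columnEst {d n : ℕ} {sel : (Fin d → ℝ) → Fin d} (r : StateRecord d n sel) : Fin d → ℂ :=
  fun j =>
    if h : j ≠ sel (freq r.1) then
      (freq (r.2 ⟨j, h⟩).1 true : ℂ) + Complex.I * (freq (r.2 ⟨j, h⟩).2 true : ℂ)
        - (1 + Complex.I) / 2 * (freq r.1 (sel (freq r.1)) : ℂ)
        - (1 + Complex.I) / 2 * (freq r.1 j : ℂ)
    else (freq r.1 (sel (freq r.1)) : ℂ)

/-- The estimate `ρ̂ = c c† / Tr(c c†)` of the state, where `c` is the estimated column. -/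
def stateEst {d n : ℕ} {sel : (Fin d → ℝ) → Fin d} (r : StateRecord d n sel) : Mat d :=
  (Matrix.trace (proj (columnEst r)))⁻¹ • proj (columnEst r)

/-! ### Probe states -/

/-- The `3d - 2` probe states: `|k⟩` for all `k`, and for all `k ≠ 1` the two superpositions
`(|1⟩ + |k⟩)/√2` and `(|1⟩ + i|k⟩)/√2`. -/
abbrev Probe (d : ℕ) [NeZero d] : Type :=
  Fin d ⊕ ({k : Fin d // k ≠ 0} ⊕ {k : Fin d // k ≠ 0})

/-- The unit vector of a probe state. -/
def probeKet {d : ℕ} [NeZero d] : Probe d → Fin d → ℂ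
  | Sum.inl k => ket k
  | Sum.inr (Sum.inl k) => ((1 / √2 : ℝ) : ℂ) • (ket 0 + ket k.1)
  | Sum.inr (Sum.inr k) => ((1 / √2 : ℝ) : ℂ) • (ket 0 + Complex.I • ket k.1)

/-- The output state `U ρ_in U†` of the gate for a probe state. -/
def outState {d : ℕ} [NeZero d] (U : Mat d) (x : Probe d) : Mat d :=
  U * proj (probeKet x) * Uᴴ

/-- The data of the whole experiment: one record for each probe state. -/
abbrev Record (d n : ℕ) [NeZero d] (sel : Probe d → (Fin d → ℝ) → Fin d) : Type :=
  (x : Probe d) → StateRecord d n (sel x)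

/-- The probability of the data `ω` when the gate is `U`. -/
def recordProb {d n : ℕ} [NeZero d] {sel : Probe d → (Fin d → ℝ) → Fin d} (U : Mat d)
    (ω : Record d n sel) : ℝ :=
  ∏ x, stateProb (outState U x) (ω x)

/-- The expectation of a function of the data when the gate is `U`. -/
def expect {d n : ℕ} [NeZero d] {sel : Probe d → (Fin d → ℝ) → Fin d} (U : Mat d)
    (f : Record d n sel → ℝ) : ℝ :=
  ∑ ω, recordProb U ω * f ω

/-- The total number of copies of probe states: there are `3d - 2` probe states, `2d - 1` POVMs for
each of them and `n` copies for each POVM. -/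
def totalCopies (d n : ℕ) : ℕ := (3 * d - 2) * ((2 * d - 1) * n)

/-! ### Gate reconstruction -/

/-- The estimate of `ε(|1⟩⟨k|)`, for `k ≠ 1` through `|1⟩⟨k| =
|+⟩⟨+| + i|-⟩⟨-| - (1+i)/2 |1⟩⟨1| - (1+i)/2 |k⟩⟨k|`. -/
def channelEst {d n : ℕ} [NeZero d] {sel : Probe d → (Fin d → ℝ) → Fin d} (ω : Record d n sel)
    (k : Fin d) : Mat d :=
  if h : k ≠ 0 then
    stateEst (ω (Sum.inr (Sum.inl ⟨k, h⟩)))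
      + Complex.I • stateEst (ω (Sum.inr (Sum.inr ⟨k, h⟩)))
      - ((1 + Complex.I) / 2) • stateEst (ω (Sum.inl 0))
      - ((1 + Complex.I) / 2) • stateEst (ω (Sum.inl k))
  else stateEst (ω (Sum.inl 0))

/-- The natural basis `|j⟩⟨k|`, used both as `{E_i}` and as `{ρ_m}`. The index `(j - 1)d + k` is
written as the pair `(j, k)`. -/
def natBasis {d : ℕ} (m : Fin d × Fin d) : Mat d := Matrix.single m.1 m.2 1

/-- The coefficients `B_{mn,jk}` in `E_j ρ_m E_k† = ∑_n B_{mn,jk} ρ_n`; the coefficient of a matrix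
at a member of the natural basis is an entry of the matrix. -/
def coeffB {d : ℕ} (m n j k : Fin d × Fin d) : ℂ :=
  (natBasis j * natBasis m * (natBasis k)ᴴ) n.1 n.2

/-- The matrix `Λ̂` of the coefficients in `ε̂(ρ_m) = ∑_n λ̂_{mn} ρ_n`. Only the rows
`ρ_m = |1⟩⟨k|` are reconstructed, and no other row is used below; the others are filled with 0. -/
def lambdaEst {d n : ℕ} [NeZero d] {sel : Probe d → (Fin d → ℝ) → Fin d} (ω : Record d n sel) :
    Matrix (Fin d × Fin d) (Fin d × Fin d) ℂ :=
  fun m p => if m.1 = 0 then channelEst ω m.2 p.1 p.2 else 0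

/-- `vec(D̂) = Bᵀ vec(Λ̂)`. -/
def matDEst {d n : ℕ} [NeZero d] {sel : Probe d → (Fin d → ℝ) → Fin d} (ω : Record d n sel) :
    Matrix (Fin d × Fin d) (Fin d × Fin d) ℂ :=
  fun j k => ∑ m, ∑ p, coeffB m p j k * lambdaEst ω m p

/-- The Euclidean norm of the row `(a - 1)d + 1` of `D̂`. -/
def rowNorm {d n : ℕ} [NeZero d] {sel : Probe d → (Fin d → ℝ) → Fin d} (ω : Record d n sel)
    (a : Fin d) : ℝ :=
  √(∑ k, ‖matDEst ω (a, 0) k‖ ^ 2)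

/-- `Ŝ = vec⁻¹` of the adjoint of the row `(j - 1)d + 1` of `D̂`, where `vec` stacks columns: the
entry of `vec(S)` at the position `(q, t)` is `S_{tq}`. -/
def matSEst {d n : ℕ} [NeZero d] {sel : Probe d → (Fin d → ℝ) → Fin d} (ω : Record d n sel)
    (j : Fin d) : Mat d :=
  fun t q => star (matDEst ω (j, 0) (q, t))

/-- `G = U₁ U₂` for a singular value decomposition `S = U₁ Σ U₂`. If `S` is invertible, then this
is `G = S |S|⁻¹`. -/
def IsPolarUnitary {d : ℕ} (S G : Mat d) : Prop :=
  ∃ U₁ ∈ Matrix.unitaryGroup (Fin d) ℂ, ∃ U₂ ∈ Matrix.unitaryGroup (Fin d) ℂ, ∃ σ : Fin d → ℝ,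
    (∀ i, 0 ≤ σ i) ∧ S = U₁ * Matrix.diagonal (fun i => (σ i : ℂ)) * U₂ ∧ G = U₁ * U₂

/-- `(j, G)` is a possible output of the reconstruction from the data `ω`: `j` maximizes the row
norm, and `G` is a unitary polar factor of the corresponding `Ŝ`. -/
def IsReconstruction {d n : ℕ} [NeZero d] {sel : Probe d → (Fin d → ℝ) → Fin d}
    (ω : Record d n sel) (j : Fin d) (G : Mat d) : Prop :=
  (∀ a, rowNorm ω a ≤ rowNorm ω j) ∧ IsPolarUnitary (matSEst ω j) G

/-- The estimated gate `Û = e^{iθ} Ĝᵀ`. The prior knowledge that calibrates the global phase is the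
phase `θ` of the entry `U_{j1}` of the gate (if this entry is zero, then `θ = 0`). -/
def gateEst {d : ℕ} [NeZero d] (U : Mat d) (j : Fin d) (G : Mat d) : Mat d :=
  Complex.exp (Complex.arg (U j 0) * Complex.I) • Gᵀ

end GateIdent

end

open scoped Matrix Matrix.Norms.Frobenius

noncomputable section

namespace GateIdent

/-! ### Expectations over finite product spaces -/

/-! The proof combines a row-wise error bound for pure-state tomography with the stability of the
unitary polar factor.

Tomography. For the state with vector ψ, the column c estimates v = (ψ_j ψ̄_s)_j, whose squared norm
is |ψ_s|². The outcomes P_j, Q_j have probability at most |ψ_s|² + |ψ_j|², so given s their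
frequencies have total variance O((d|ψ_s|² + 1)/n). If |ψ_s|² is comparable to the maximum M of the
|ψ_j|², dividing by the squared column norm leaves O(d/n), because M ≥ 1/d. The error of ρ̂_ss
enters every entry of c, but a single row of the normalized projection feels it only as d times its
square, again O(d/n) in mean. This is `sum_norm_sq_lineProj_sub_proj_le`. It requires that |ψ_s|² ≥
M/4 and that the frequency of s is accurate. Exponential moments bound the failure probability by 2
exp(-n/(32d)) for each s, and a union bound over s is affordable when n ≥ d². The resulting
`rowBound` does not depend on the row, and its mean is O(d/n).

Gate. Row a of the d matrices ε(|1⟩⟨k|) forms the matrix star (U a 0) • Uᵀ, of norm |U a 0| √d. Its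
total squared error is at most W, of mean O(d²/n), for all a at once; this uniformity matters
because j is chosen from the data. Some |U a 0| is at least 1/√d, so for small W the row of largest
norm has |U j 0| √d ≥ 1/2. Since the polar factor is the closest unitary at every scale, the squared
gate error is O(dW), with mean O(d³/n). If W is not small or n < d², the trivial bound 4d suffices.
Finally N ≤ 6d²n turns d³/n into O(d⁵/N), and the mean is controlled by the root mean square. -/

theorem sum_pi_prod {ι : Type*} [Fintype ι] [DecidableEq ι] {α : ι → Type*} [∀ i, Fintype (α i)]
    (f : ∀ i, α i → ℝ) : ∑ r : (∀ i, α i), ∏ i, f i (r i) = ∏ i, ∑ x, f i x := by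
  classical
  rw [Finset.prod_univ_sum, Fintype.piFinset_univ]

/-- The marginal of a product distribution. -/
theorem sum_pi_prod_mul {ι : Type*} [Fintype ι] [DecidableEq ι] {α : ι → Type*}
    [∀ i, Fintype (α i)] (w : ∀ i, α i → ℝ) (hw : ∀ i, ∑ x, w i x = 1) (i : ι) (h : α i → ℝ) :
    ∑ r : (∀ i, α i), (∏ i, w i (r i)) * h (r i) = ∑ x, w i x * h x := by
  classical
  -- The test function is absorbed into the factor at i, so the product formula applies; all other
  -- factors have total mass 1.
  let f : ∀ k, α k → ℝ := fun k x => w k x * if e : k = i then h (e ▸ x) else 1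
  have h1 : ∀ r : (∀ i, α i), (∏ i, w i (r i)) * h (r i) = ∏ k, f k (r k) := by
    intro r
    simp only [f, Finset.prod_mul_distrib]
    congr 1
    rw [Finset.prod_eq_single i]
    · simp
    · intro b _ hb; simp [hb]
    · simp
  simp only [h1]
  rw [sum_pi_prod, Finset.prod_eq_single i]
  · simp [f]
  · intro b _ hb; simp [f, hb, hw]
  · simp

/-- The expectation of a sum of functions of the single coordinates. -/
theorem sum_pi_prod_mul_sum {ι : Type*} [Fintype ι] [DecidableEq ι] {α : ι → Type*}
    [∀ i, Fintype (α i)] (w : ∀ i, α i → ℝ) (hw : ∀ i, ∑ x, w i x = 1) (h : ∀ i, α i → ℝ) :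
    ∑ r : (∀ i, α i), (∏ i, w i (r i)) * ∑ i, h i (r i) = ∑ i, ∑ x, w i x * h i x := by
  simp only [Finset.mul_sum]
  rw [Finset.sum_comm]
  exact Finset.sum_congr rfl fun i _ => sum_pi_prod_mul w hw i (h i)

theorem freq_mul {α : Type} [DecidableEq α] {n : ℕ} (hn : 0 < n) (a : Fin n → α) (x : α) :
    (n : ℝ) * freq a x = ∑ i, if a i = x then (1 : ℝ) else 0 := by
  have : (n : ℝ) ≠ 0 := by positivity
  simp only [freq]
  rw [mul_div_cancel₀ _ this]
  simp

/-! ### Moments and tail bounds for empirical frequencies -/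

section Iid

variable {α : Type} [Fintype α] (w : α → ℝ)

theorem sum_iid_mul_prod (n : ℕ) (g : α → ℝ) :
    ∑ a : Fin n → α, (∏ i, w (a i)) * ∏ i, g (a i) = (∑ x, w x * g x) ^ n := by
  simp only [← Finset.prod_mul_distrib]
  rw [sum_pi_prod (fun (_ : Fin n) x => w x * g x)]
  simp

theorem sum_iid (hw : ∑ x, w x = 1) (n : ℕ) : ∑ a : Fin n → α, ∏ i, w (a i) = 1 := by
  have := sum_iid_mul_prod w n (fun _ => 1)
  simpa [hw] using this

/-- The variance of a sum of independent centred variables. -/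
theorem sum_iid_sq (hw : ∑ x, w x = 1) (g : α → ℝ) (hg : ∑ x, w x * g x = 0) (n : ℕ) :
    ∑ a : Fin n → α, (∏ i, w (a i)) * (∑ i, g (a i)) ^ 2 = n * ∑ x, w x * g x ^ 2 := by
  have key : ∀ m : ℕ, ∀ F : (Fin (m + 1) → α) → ℝ,
      ∑ a, F a = ∑ x, ∑ b : Fin m → α, F (Fin.cons x b) := by
    intro m F
    rw [← (Fin.consEquiv fun _ => α).sum_comp, Fintype.sum_prod_type]
    rfl
  have lin : ∑ a : Fin n → α, (∏ i, w (a i)) * ∑ i, g (a i) = 0 := by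
    rw [sum_pi_prod_mul_sum (fun (_ : Fin n) => w) (fun _ => hw) (fun _ => g)]
    simp [hg]
  induction n with
  | zero => simp
  | succ m ih =>
    have lin' : ∑ a : Fin m → α, (∏ i, w (a i)) * ∑ i, g (a i) = 0 := by
      rw [sum_pi_prod_mul_sum (fun (_ : Fin m) => w) (fun _ => hw) (fun _ => g)]
      simp [hg]
    rw [key]
    simp only [Fin.prod_univ_succ, Fin.sum_univ_succ, Fin.cons_zero, Fin.cons_succ]
    have : ∀ x : α, ∑ b : Fin m → α, w x * (∏ i, w (b i)) * (g x + ∑ i, g (b i)) ^ 2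
        = w x * g x ^ 2 + w x * (m * ∑ y, w y * g y ^ 2) := by
      intro x
      -- The first outcome is split off; the cross term vanishes because the remaining sum is
      -- centred.
      have e : ∀ b : Fin m → α, w x * (∏ i, w (b i)) * (g x + ∑ i, g (b i)) ^ 2 =
          w x * g x ^ 2 * ∏ i, w (b i) + 2 * w x * g x * ((∏ i, w (b i)) * ∑ i, g (b i))
            + w x * ((∏ i, w (b i)) * (∑ i, g (b i)) ^ 2) := by intro b; ring
      simp only [e, Finset.sum_add_distrib, ← Finset.mul_sum, sum_iid w hw, lin', ih lin']
      ring
    rw [Finset.sum_congr rfl fun x _ => this x, Finset.sum_add_distrib, ← Finset.sum_mul, hw]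
    push_cast; ring

/-- The exponential Markov inequality for a sum of independent variables. -/
theorem sum_iid_indicator_le (hw0 : ∀ x, 0 ≤ w x) (n : ℕ) (u : α → ℝ) (L : ℝ)
    (hL : ∑ x, w x * Real.exp (u x) ≤ Real.exp L) (p : (Fin n → α) → Prop) [DecidablePred p]
    (hp : ∀ a, p a → 0 ≤ ∑ i, u (a i)) :
    ∑ a : Fin n → α, (∏ i, w (a i)) * (if p a then 1 else 0) ≤ Real.exp (n * L) := by
  calc _ ≤ ∑ a : Fin n → α, (∏ i, w (a i)) * ∏ i, Real.exp (u (a i)) := by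
        refine Finset.sum_le_sum fun a _ => mul_le_mul_of_nonneg_left ?_
          (Finset.prod_nonneg fun i _ => hw0 _)
        rw [← Real.exp_sum]
        split_ifs with h
        · exact Real.one_le_exp (hp a h)
        · positivity
    _ = (∑ x, w x * Real.exp (u x)) ^ n :=
        sum_iid_mul_prod w n fun x => Real.exp (u x)
    _ ≤ Real.exp L ^ n := by
        have h0 : 0 ≤ ∑ x, w x * Real.exp (u x) :=
          Finset.sum_nonneg fun x _ => mul_nonneg (hw0 x) (Real.exp_pos _).le
        exact pow_le_pow_left₀ h0 hL n
    _ = _ := by rw [← Real.exp_nat_mul]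

variable [DecidableEq α]

/-- The mean square error of a relative frequency. -/
theorem sum_iid_freq_sq_le (hw : ∑ x, w x = 1) {n : ℕ} (hn : 0 < n) (x : α) :
    ∑ a : Fin n → α, (∏ i, w (a i)) * (freq a x - w x) ^ 2 ≤ w x / n := by
  have hn' : (0 : ℝ) < n := by positivity
  let g : α → ℝ := fun y => (if y = x then 1 else 0) - w x
  have hg : ∑ y, w y * g y = 0 := by
    simp [g, mul_sub, Finset.sum_sub_distrib, ← Finset.sum_mul, hw]
  have hg2 : ∑ y, w y * g y ^ 2 = w x - w x ^ 2 := by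
    have e : ∀ y, w y * g y ^ 2 = (if y = x then w y * (1 - 2 * w x) else 0) + w y * w x ^ 2 := by
      intro y; by_cases h : y = x <;> simp [g, h]; ring
    simp only [e, Finset.sum_add_distrib, ← Finset.sum_mul, hw]
    simp; ring
  have h1 : ∀ a : Fin n → α, (freq a x - w x) ^ 2 = (∑ i, g (a i)) ^ 2 / n ^ 2 := by
    intro a
    have : ∑ i, g (a i) = n * (freq a x - w x) := by
      rw [mul_sub, freq_mul hn]
      simp [g, Finset.sum_sub_distrib]
    rw [this]; field_simp
  simp only [h1, mul_div_assoc']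
  rw [← Finset.sum_div, sum_iid_sq w hw g hg, hg2, div_le_div_iff₀ (by positivity) hn']
  nlinarith [mul_nonneg (sq_nonneg (n : ℝ)) (sq_nonneg (w x))]

theorem sum_mul_exp_indicator (hw : ∑ x, w x = 1) (s : α) (t : ℝ) :
    ∑ x, w x * Real.exp (t * if x = s then 1 else 0) = 1 + w s * (Real.exp t - 1) := by
  have e : ∀ x, w x * Real.exp (t * if x = s then 1 else 0)
      = (if x = s then w x * (Real.exp t - 1) else 0) + w x := by
    intro x; by_cases h : x = s <;> simp [h]; ring
  simp only [e, Finset.sum_add_distrib, hw]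
  simp; ring

/-- One outcome is rarely more frequent than another one which is four times as probable. -/
theorem sum_iid_freq_le_freq (hw0 : ∀ x, 0 ≤ w x) (hw : ∑ x, w x = 1) {n : ℕ} (hn : 0 < n)
    {s m : α} (hs : w s ≤ w m / 4) (hm : 0 < w m) :
    ∑ a : Fin n → α, (∏ i, w (a i)) * (if freq a m ≤ freq a s then 1 else 0)
      ≤ Real.exp (-(n * (w m / 4))) := by
  have hn' : (0 : ℝ) < n := by positivity
  have hne : s ≠ m := by rintro rfl; linarith
  -- The exponential moment is that of 2^(1_s - 1_m). Its mean is 1 + w s - w m / 2 ≤ 1 - w m / 4.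
  let u : α → ℝ := fun x => Real.log 2 * ((if x = s then 1 else 0) - if x = m then 1 else 0)
  have h := sum_iid_indicator_le w hw0 n u (-(w m / 4)) ?_ (fun a => freq a m ≤ freq a s) ?_
  · simpa using h
  · have e : ∀ x, w x * Real.exp (u x)
        = (if x = s then w x else 0) + (if x = m then - (w x / 2) else 0) + w x := by
      intro x
      by_cases h1 : x = s
      · subst h1; simp [u, hne, Real.exp_log]; ring
      · by_cases h2 : x = m
        · subst h2; simp [u, h1, Real.exp_neg, Real.exp_log]; ring
        · simp [u, h1, h2]
    simp only [e, Finset.sum_add_distrib, hw]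
    simp only [Finset.sum_ite_eq', Finset.mem_univ, if_true]
    linarith [Real.add_one_le_exp (-(w m / 4))]
  · intro a h
    have : ∑ i, u (a i) = Real.log 2 * (n * freq a s - n * freq a m) := by
      simp only [u, ← Finset.mul_sum, Finset.sum_sub_distrib, freq_mul hn]
    rw [this]
    have := Real.log_pos (by norm_num : (1 : ℝ) < 2)
    have : (n : ℝ) * freq a m ≤ n * freq a s := by gcongr
    exact mul_nonneg (by linarith) (by linarith)

/-- A relative frequency has subgaussian tails in the range of moderate deviations. -/
theorem sum_iid_lt_abs_freq_sub (hw0 : ∀ x, 0 ≤ w x) (hw : ∑ x, w x = 1) {n : ℕ} (hn : 0 < n)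
    {s : α} {η : ℝ} (hη : 0 ≤ η) (hs : 0 < w s) (hηs : η ≤ 2 * w s) :
    ∑ a : Fin n → α, (∏ i, w (a i)) * (if η < |freq a s - w s| then 1 else 0)
      ≤ 2 * Real.exp (-(n * (η ^ 2 / (4 * w s)))) := by
  have hn' : (0 : ℝ) < n := by positivity
  set p := w s with hp
  -- The value |t| = η/(2p) minimizes p t² - |t| η, with minimum -η²/(4p). The condition η ≤ 2p
  -- gives |t| ≤ 1, the range where exp t ≤ 1 + t + t² is available. The two signs of t treat the
  -- two tails.
  have one : ∀ t : ℝ, |t| = η / (2 * p) →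
      ∑ a : Fin n → α, (∏ i, w (a i)) * (if |t| * η ≤ t * (freq a s - p) then 1 else 0)
        ≤ Real.exp (-(n * (η ^ 2 / (4 * p)))) := by
    intro t ht
    have ht1 : |t| ≤ 1 := by rw [ht, div_le_one (by positivity)]; exact hηs
    let u : α → ℝ := fun x => t * (if x = s then 1 else 0) - (t * p + |t| * η)
    have h := sum_iid_indicator_le w hw0 n u (-(η ^ 2 / (4 * p))) ?_
      (fun a => |t| * η ≤ t * (freq a s - p)) ?_
    · simpa using h
    · have e : ∀ x, w x * Real.exp (u x) = w x * Real.exp (t * if x = s then 1 else 0) *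
          Real.exp (-(t * p + |t| * η)) := by
        intro x; simp only [u, sub_eq_add_neg, Real.exp_add]; ring
      simp only [e, ← Finset.sum_mul, sum_mul_exp_indicator w hw]
      have h1 : Real.exp t - 1 ≤ t + t ^ 2 := by
        have := (abs_le.1 (Real.abs_exp_sub_one_sub_id_le ht1)).2
        linarith
      have h2 : 1 + p * (Real.exp t - 1) ≤ Real.exp (p * (t + t ^ 2)) := by
        have := Real.add_one_le_exp (p * (t + t ^ 2))
        nlinarith
      calc (1 + w s * (Real.exp t - 1)) * Real.exp (-(t * p + |t| * η))
          ≤ Real.exp (p * (t + t ^ 2)) * Real.exp (-(t * p + |t| * η)) := by gcongr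
        _ = Real.exp (-(η ^ 2 / (4 * p))) := by
          rw [← Real.exp_add]
          congr 1
          rw [← sq_abs t, ht]
          field_simp
          ring
    · intro a h
      have : ∑ i, u (a i) = n * (t * (freq a s - p) - |t| * η) := by
        simp only [u, Finset.sum_sub_distrib, ← Finset.mul_sum, ← freq_mul hn]
        simp; ring
      rw [this]
      exact mul_nonneg hn'.le (by linarith)
  have h0 : 0 ≤ η / (2 * p) := by positivity
  have hpos := one (η / (2 * p)) (abs_of_nonneg h0)
  have hneg := one (-(η / (2 * p))) (by rw [abs_neg, abs_of_nonneg h0])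
  rw [two_mul]
  refine le_trans ?_ (add_le_add hpos hneg)
  rw [← Finset.sum_add_distrib]
  refine Finset.sum_le_sum fun a _ => ?_
  rw [← mul_add]
  refine mul_le_mul_of_nonneg_left ?_ (Finset.prod_nonneg fun i _ => hw0 _)
  rw [abs_neg, abs_of_nonneg h0]
  split_ifs with h1 h2 h3 h3 <;> try norm_num
  exfalso
  rcases lt_abs.1 h1 with h | h
  · exact h2 (by gcongr)
  · refine h3 ?_
    have : η / (2 * p) * η ≤ η / (2 * p) * -(freq a s - p) := by gcongr
    linarith

end Iid

/-! ### Born probabilities of a pure state -/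

section Born

variable {d : ℕ}

theorem trace_proj_mul_proj (ψ v : Fin d → ℂ) :
    Matrix.trace (proj ψ * proj v) = ((‖star v ⬝ᵥ ψ‖ ^ 2 : ℝ) : ℂ) := by
  rw [proj, proj, Matrix.vecMulVec_mul_vecMulVec, Matrix.vecMulVec_smul, Matrix.trace_smul,
    Matrix.trace_vecMulVec, Matrix.star_dotProduct ψ v, dotProduct_comm ψ, smul_eq_mul, mul_comm]
  push_cast
  exact Complex.mul_conj' _

theorem born_proj_proj (ψ v : Fin d → ℂ) : born (proj ψ) (proj v) = ‖star v ⬝ᵥ ψ‖ ^ 2 := by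
  rw [born, trace_proj_mul_proj, Complex.ofReal_re]

theorem trace_proj (ψ : Fin d → ℂ) :
    Matrix.trace (proj ψ) = ((∑ j, ‖ψ j‖ ^ 2 : ℝ) : ℂ) := by
  rw [proj, Matrix.trace_vecMulVec, dotProduct]
  push_cast
  exact Finset.sum_congr rfl fun j _ => Complex.mul_conj' _

theorem born_one_sub {ψ : Fin d → ℂ} (hψ : ∑ j, ‖ψ j‖ ^ 2 = 1) (P : Mat d) :
    born (proj ψ) (1 - P) = 1 - born (proj ψ) P := by
  rw [born, mul_sub, mul_one, Matrix.trace_sub, trace_proj, hψ]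
  simp [born]

theorem born_half_proj (ψ v : Fin d → ℂ) :
    born (proj ψ) ((1 / 2 : ℂ) • proj v) = ‖star v ⬝ᵥ ψ‖ ^ 2 / 2 := by
  rw [born, Matrix.mul_smul, Matrix.trace_smul, trace_proj_mul_proj, smul_eq_mul,
    show (1 / 2 : ℂ) = ((1 / 2 : ℝ) : ℂ) by push_cast; rfl, ← Complex.ofReal_mul,
    Complex.ofReal_re]
  ring

theorem star_ket_dotProduct (ψ : Fin d → ℂ) (j : Fin d) : star (ket j) ⬝ᵥ ψ = ψ j := by
  have : star (ket j : Fin d → ℂ) = Pi.single j 1 := by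
    ext i
    by_cases h : i = j
    · subst h; simp [ket]
    · simp [ket, h]
  rw [this, single_dotProduct, one_mul]

theorem born_basisPOVM (ψ : Fin d → ℂ) (j : Fin d) :
    born (proj ψ) (basisPOVM d j) = ‖ψ j‖ ^ 2 := by
  rw [basisPOVM, born_proj_proj, star_ket_dotProduct]

theorem born_effP (ψ : Fin d → ℂ) (s j : Fin d) :
    born (proj ψ) (effP s j)
      = (‖ψ s‖ ^ 2 + ‖ψ j‖ ^ 2) / 2 + (ψ j * star (ψ s)).re := by
  rw [effP, born_half_proj, star_add, add_dotProduct, star_ket_dotProduct, star_ket_dotProduct]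
  simp only [Complex.sq_norm, Complex.normSq_apply]
  simp
  ring

theorem born_effQ (ψ : Fin d → ℂ) (s j : Fin d) :
    born (proj ψ) (effQ s j)
      = (‖ψ s‖ ^ 2 + ‖ψ j‖ ^ 2) / 2 + (ψ j * star (ψ s)).im := by
  rw [effQ, born_half_proj, star_add, add_dotProduct, star_smul, smul_dotProduct,
    star_ket_dotProduct, star_ket_dotProduct]
  simp only [Complex.sq_norm, Complex.normSq_apply]
  simp
  ring

theorem norm_mul_star_le (x y : ℂ) : ‖x * star y‖ ≤ (‖y‖ ^ 2 + ‖x‖ ^ 2) / 2 := by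
  rw [norm_mul, norm_star]
  nlinarith [sq_nonneg (‖x‖ - ‖y‖)]

theorem born_effP_nonneg (ψ : Fin d → ℂ) (s j : Fin d) : 0 ≤ born (proj ψ) (effP s j) := by
  rw [effP, born_half_proj]; positivity

theorem born_effQ_nonneg (ψ : Fin d → ℂ) (s j : Fin d) : 0 ≤ born (proj ψ) (effQ s j) := by
  rw [effQ, born_half_proj]; positivity

/-- The interference term is absorbed by the arithmetic-geometric mean inequality. This probability
bounds the variance of the frequency; the trivial bound 1 would lose the factor |ψ_s|² on summing
over j. -/
theorem born_effP_le (ψ : Fin d → ℂ) (s j : Fin d) :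
    born (proj ψ) (effP s j) ≤ ‖ψ s‖ ^ 2 + ‖ψ j‖ ^ 2 := by
  rw [born_effP]
  linarith [Complex.re_le_norm (ψ j * star (ψ s)), norm_mul_star_le (ψ j) (ψ s)]

theorem born_effQ_le (ψ : Fin d → ℂ) (s j : Fin d) :
    born (proj ψ) (effQ s j) ≤ ‖ψ s‖ ^ 2 + ‖ψ j‖ ^ 2 := by
  rw [born_effQ]
  linarith [Complex.im_le_norm (ψ j * star (ψ s)), norm_mul_star_le (ψ j) (ψ s)]

theorem sq_norm_add_sq_norm_le_one {ψ : Fin d → ℂ} (hψ : ∑ j, ‖ψ j‖ ^ 2 = 1) {s j : Fin d}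
    (h : j ≠ s) : ‖ψ s‖ ^ 2 + ‖ψ j‖ ^ 2 ≤ 1 := by
  rw [← hψ, ← Finset.sum_pair (f := fun i => ‖ψ i‖ ^ 2) h.symm]
  exact Finset.sum_le_sum_of_subset_of_nonneg (Finset.subset_univ _) fun _ _ _ => by positivity

end Born

/-! ### The distribution of the record of one state -/

section StateRecord

variable {d n : ℕ} {sel : (Fin d → ℝ) → Fin d} {ψ : Fin d → ℂ}

theorem sum_born_yesNo (hψ : ∑ j, ‖ψ j‖ ^ 2 = 1) (P : Mat d) :
    ∑ b, born (proj ψ) (yesNo P b) = 1 := by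
  simp [yesNo, born_one_sub hψ]

/-- For j ≠ s the probability of `effP` is at most |ψ_s|² + |ψ_j|² ≤ 1. The condition is needed:
`effP s s` is 2|s⟩⟨s|, which is not an effect. -/
theorem born_yesNo_effP_nonneg (hψ : ∑ j, ‖ψ j‖ ^ 2 = 1) {s j : Fin d} (h : j ≠ s) (b : Bool) :
    0 ≤ born (proj ψ) (yesNo (effP s j) b) := by
  have := born_effP_le ψ s j
  have := sq_norm_add_sq_norm_le_one hψ h
  cases b
  · simp [yesNo, born_one_sub hψ]; linarith
  · simpa [yesNo] using born_effP_nonneg ψ s j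

theorem born_yesNo_effQ_nonneg (hψ : ∑ j, ‖ψ j‖ ^ 2 = 1) {s j : Fin d} (h : j ≠ s) (b : Bool) :
    0 ≤ born (proj ψ) (yesNo (effQ s j) b) := by
  have := born_effQ_le ψ s j
  have := sq_norm_add_sq_norm_le_one hψ h
  cases b
  · simp [yesNo, born_one_sub hψ]; linarith
  · simpa [yesNo] using born_effQ_nonneg ψ s j

theorem stateProb_nonneg (hψ : ∑ j, ‖ψ j‖ ^ 2 = 1) (r : StateRecord d n sel) :
    0 ≤ stateProb (proj ψ) r := by
  refine mul_nonneg (Finset.prod_nonneg fun i _ => ?_) (Finset.prod_nonneg fun j _ =>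
    mul_nonneg (Finset.prod_nonneg fun i _ => born_yesNo_effP_nonneg hψ j.2 _)
      (Finset.prod_nonneg fun i _ => born_yesNo_effQ_nonneg hψ j.2 _))
  rw [born_basisPOVM]; positivity

theorem sum_seqProb_yesNo (hψ : ∑ j, ‖ψ j‖ ^ 2 = 1) (P : Mat d) :
    ∑ b : Fin n → Bool, seqProb (proj ψ) (yesNo P) b = 1 :=
  sum_iid _ (sum_born_yesNo hψ P) n

/-- The probability of the outcomes of all two-outcome measurements, given the index `s`. -/
def offProb (ψ : Fin d → ℂ) (s : Fin d)
    (b : {j : Fin d // j ≠ s} → (Fin n → Bool) × (Fin n → Bool)) : ℝ :=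
  ∏ j : {j : Fin d // j ≠ s}, (seqProb (proj ψ) (yesNo (effP s j.1)) (b j).1 *
    seqProb (proj ψ) (yesNo (effQ s j.1)) (b j).2)

/-- The quadratic error of the frequencies in the two-outcome measurements. -/
def offErr (ψ : Fin d → ℂ) (s : Fin d)
    (b : {j : Fin d // j ≠ s} → (Fin n → Bool) × (Fin n → Bool)) : ℝ :=
  ∑ j : {j : Fin d // j ≠ s}, (2 * (freq (b j).1 true - born (proj ψ) (effP s j.1)) ^ 2 +
    2 * (freq (b j).2 true - born (proj ψ) (effQ s j.1)) ^ 2)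

theorem sum_seqProb_pair (hψ : ∑ j, ‖ψ j‖ ^ 2 = 1) (P Q : Mat d) :
    ∑ c : (Fin n → Bool) × (Fin n → Bool),
      seqProb (proj ψ) (yesNo P) c.1 * seqProb (proj ψ) (yesNo Q) c.2 = 1 := by
  rw [Fintype.sum_prod_type]
  simp [← Finset.mul_sum, sum_seqProb_yesNo hψ]

theorem sum_offProb (hψ : ∑ j, ‖ψ j‖ ^ 2 = 1) (s : Fin d) :
    ∑ b, offProb (n := n) ψ s b = 1 := by
  simp only [offProb]
  rw [sum_pi_prod (fun (j : {j : Fin d // j ≠ s}) (c : (Fin n → Bool) × (Fin n → Bool)) =>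
    seqProb (proj ψ) (yesNo (effP s j.1)) c.1 * seqProb (proj ψ) (yesNo (effQ s j.1)) c.2)]
  exact Finset.prod_eq_one fun j _ => sum_seqProb_pair hψ _ _

theorem sum_seqProb_yesNo_freq_le (hψ : ∑ j, ‖ψ j‖ ^ 2 = 1) (hn : 0 < n) (P : Mat d) :
    ∑ b : Fin n → Bool, seqProb (proj ψ) (yesNo P) b * (freq b true - born (proj ψ) P) ^ 2
      ≤ born (proj ψ) P / n := by
  have := sum_iid_freq_sq_le (fun b => born (proj ψ) (yesNo P b)) (sum_born_yesNo hψ P) hn true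
  simpa [yesNo, seqProb] using this

/-- Each frequency has variance at most its probability over n. Summing |ψ_s|² + |ψ_j|² over j gives
d|ψ_s|² + 1. -/
theorem sum_offProb_mul_offErr_le (hψ : ∑ j, ‖ψ j‖ ^ 2 = 1) (hn : 0 < n) (s : Fin d) :
    ∑ b, offProb (n := n) ψ s b * offErr ψ s b ≤ 4 * (d * ‖ψ s‖ ^ 2 + 1) / n := by
  have hn' : (0 : ℝ) < n := by positivity
  simp only [offProb, offErr]
  rw [sum_pi_prod_mul_sum (fun (j : {j : Fin d // j ≠ s}) (c : (Fin n → Bool) × (Fin n → Bool)) =>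
      seqProb (proj ψ) (yesNo (effP s j.1)) c.1 * seqProb (proj ψ) (yesNo (effQ s j.1)) c.2)
    (fun j => sum_seqProb_pair hψ _ _)
    (fun j c => 2 * (freq c.1 true - born (proj ψ) (effP s j.1)) ^ 2 +
      2 * (freq c.2 true - born (proj ψ) (effQ s j.1)) ^ 2)]
  have one : ∀ j : {j : Fin d // j ≠ s}, ∑ c : (Fin n → Bool) × (Fin n → Bool),
      seqProb (proj ψ) (yesNo (effP s j.1)) c.1 * seqProb (proj ψ) (yesNo (effQ s j.1)) c.2 *
        (2 * (freq c.1 true - born (proj ψ) (effP s j.1)) ^ 2 +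
          2 * (freq c.2 true - born (proj ψ) (effQ s j.1)) ^ 2)
      ≤ 4 * (‖ψ s‖ ^ 2 + ‖ψ j.1‖ ^ 2) / n := by
    intro j
    rw [Fintype.sum_prod_type]
    have e : ∀ x y : Fin n → Bool,
        seqProb (proj ψ) (yesNo (effP s j.1)) x * seqProb (proj ψ) (yesNo (effQ s j.1)) y *
          (2 * (freq x true - born (proj ψ) (effP s j.1)) ^ 2 +
            2 * (freq y true - born (proj ψ) (effQ s j.1)) ^ 2) =
        (2 * (seqProb (proj ψ) (yesNo (effP s j.1)) x *
          (freq x true - born (proj ψ) (effP s j.1)) ^ 2)) *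
            seqProb (proj ψ) (yesNo (effQ s j.1)) y +
        seqProb (proj ψ) (yesNo (effP s j.1)) x * (2 * (seqProb (proj ψ) (yesNo (effQ s j.1)) y *
          (freq y true - born (proj ψ) (effQ s j.1)) ^ 2)) := by intro x y; ring
    simp only [e, Finset.sum_add_distrib, ← Finset.mul_sum, ← Finset.sum_mul,
      sum_seqProb_yesNo hψ, mul_one, one_mul]
    have h1 := sum_seqProb_yesNo_freq_le (n := n) hψ hn (effP s j.1)
    have h2 := sum_seqProb_yesNo_freq_le (n := n) hψ hn (effQ s j.1)
    have h3 : born (proj ψ) (effP s j.1) / n ≤ (‖ψ s‖ ^ 2 + ‖ψ j.1‖ ^ 2) / n := by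
      gcongr; exact born_effP_le ψ s j.1
    have h4 : born (proj ψ) (effQ s j.1) / n ≤ (‖ψ s‖ ^ 2 + ‖ψ j.1‖ ^ 2) / n := by
      gcongr; exact born_effQ_le ψ s j.1
    rw [mul_div_assoc]
    linarith
  calc _ ≤ ∑ j : {j : Fin d // j ≠ s}, 4 * (‖ψ s‖ ^ 2 + ‖ψ j.1‖ ^ 2) / n :=
        Finset.sum_le_sum fun j _ => one j
    _ ≤ ∑ j : Fin d, 4 * (‖ψ s‖ ^ 2 + ‖ψ j‖ ^ 2) / n := by
        rw [← Fintype.sum_subtype_add_sum_subtype (fun j : Fin d => j ≠ s)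
          fun j => 4 * (‖ψ s‖ ^ 2 + ‖ψ j‖ ^ 2) / (n : ℝ)]
        exact le_add_of_nonneg_right (Finset.sum_nonneg fun _ _ => by positivity)
    _ = _ := by
        rw [← Finset.sum_div, ← Finset.mul_sum, Finset.sum_add_distrib, hψ]
        simp

/-- The expectation over the record of one state, as an iterated expectation. -/
theorem sum_stateProb_mul (F : StateRecord d n sel → ℝ) :
    ∑ r, stateProb (proj ψ) r * F r = ∑ a : Fin n → Fin d, (∏ i, ‖ψ (a i)‖ ^ 2) *
      ∑ b, offProb ψ (sel (freq a)) b * F ⟨a, b⟩ := by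
  rw [Fintype.sum_sigma]
  refine Finset.sum_congr rfl fun a _ => ?_
  rw [Finset.mul_sum]
  refine Finset.sum_congr rfl fun b _ => ?_
  simp only [stateProb, seqProb, offProb, born_basisPOVM, mul_assoc]

theorem sum_stateProb (hψ : ∑ j, ‖ψ j‖ ^ 2 = 1) :
    ∑ r : StateRecord d n sel, stateProb (proj ψ) r = 1 := by
  have := sum_stateProb_mul (ψ := ψ) (n := n) (sel := sel) (fun _ => 1)
  simp only [mul_one, sum_offProb hψ] at this
  rw [this]
  exact sum_iid _ hψ n

end StateRecord

/-! ### Perturbation of a rank-one projection -/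

section Perturbation

variable {d : ℕ}

/-- The projection onto the line spanned by a vector. -/
def lineProj (c : Fin d → ℂ) : Mat d := (Matrix.trace (proj c))⁻¹ • proj c

theorem lineProj_apply (c : Fin d → ℂ) (j t : Fin d) :
    lineProj c j t = ((∑ i, ‖c i‖ ^ 2 : ℝ) : ℂ)⁻¹ * (c j * star (c t)) := by
  rw [lineProj, trace_proj]; rfl

/-- A row of a projection has norm at most 1. For c = 0 the inverse of the trace is 0 by convention
and the row vanishes. -/
theorem sum_norm_sq_lineProj_le (c : Fin d → ℂ) (j : Fin d) :
    ∑ t, ‖lineProj c j t‖ ^ 2 ≤ 1 := by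
  set T := ∑ i, ‖c i‖ ^ 2 with hT
  have hT0 : 0 ≤ T := Finset.sum_nonneg fun _ _ => by positivity
  have h1 : ‖c j‖ ^ 2 ≤ T :=
    Finset.single_le_sum (f := fun i => ‖c i‖ ^ 2) (fun _ _ => by positivity) (Finset.mem_univ j)
  have e : ∀ t, ‖lineProj c j t‖ ^ 2 = T⁻¹ ^ 2 * ‖c j‖ ^ 2 * ‖c t‖ ^ 2 := by
    intro t
    rw [lineProj_apply, ← hT, norm_mul, norm_mul, norm_star, norm_inv, Complex.norm_real,
      Real.norm_of_nonneg hT0]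
    ring
  simp only [e, ← Finset.mul_sum, ← hT]
  rcases hT0.eq_or_lt with h | h
  · simp [← h]
  · have : T⁻¹ ^ 2 * ‖c j‖ ^ 2 * T = ‖c j‖ ^ 2 / T := by field_simp
    rw [this, div_le_one h]; exact h1

theorem sum_norm_sq_lineProj_sub_le (c v : Fin d → ℂ) (j : Fin d) :
    ∑ t, ‖lineProj c j t - lineProj v j t‖ ^ 2 ≤ 4 := by
  have h : ∀ t, ‖lineProj c j t - lineProj v j t‖ ^ 2
      ≤ 2 * ‖lineProj c j t‖ ^ 2 + 2 * ‖lineProj v j t‖ ^ 2 := by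
    intro t
    have := pow_le_pow_left₀ (norm_nonneg _) (norm_sub_le (lineProj c j t) (lineProj v j t)) 2
    nlinarith [sq_nonneg (‖lineProj c j t‖ - ‖lineProj v j t‖)]
  have := Finset.sum_le_sum fun t (_ : t ∈ Finset.univ) => h t
  rw [Finset.sum_add_distrib, ← Finset.mul_sum, ← Finset.mul_sum] at this
  linarith [sum_norm_sq_lineProj_le c j, sum_norm_sq_lineProj_le v j]

/-- The inversion x ↦ x/‖x‖² satisfies the exact distance formula ‖x - y‖/(‖x‖‖y‖). The scalars z
and w are then exchanged by the triangle inequality. -/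
theorem norm_smul_inversion_sub_le {E : Type*} [NormedAddCommGroup E] [InnerProductSpace ℂ E]
    {x y : E} (hx : x ≠ 0) (hy : y ≠ 0) (z w : ℂ) :
    ‖(((‖x‖ ^ 2 : ℝ) : ℂ)⁻¹ * z) • x - (((‖y‖ ^ 2 : ℝ) : ℂ)⁻¹ * w) • y‖
      ≤ ‖z - w‖ / ‖x‖ + ‖w‖ * (‖x - y‖ / (‖x‖ * ‖y‖)) := by
  let _ : InnerProductSpace ℝ E := InnerProductSpace.complexToReal
  have hx' := norm_pos_iff.2 hx
  have h := dist_div_norm_sq_smul hx hy 1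
  rw [dist_eq_norm, dist_eq_norm] at h
  have c1 : ∀ u : E, ((1 / ‖u‖) ^ 2 : ℝ) • u = (((‖u‖ ^ 2 : ℝ) : ℂ)⁻¹) • u := by
    intro u
    rw [← Complex.coe_smul]
    congr 1
    push_cast
    simp
  rw [c1, c1] at h
  have e : (((‖x‖ ^ 2 : ℝ) : ℂ)⁻¹ * z) • x - (((‖y‖ ^ 2 : ℝ) : ℂ)⁻¹ * w) • y
      = (((‖x‖ ^ 2 : ℝ) : ℂ)⁻¹ * (z - w)) • x
        + w • ((((‖x‖ ^ 2 : ℝ) : ℂ)⁻¹) • x - (((‖y‖ ^ 2 : ℝ) : ℂ)⁻¹) • y) := by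
    module
  rw [e]
  refine (norm_add_le _ _).trans (add_le_add ?_ ?_)
  · rw [norm_smul, norm_mul, norm_inv, Complex.norm_real, Real.norm_of_nonneg (by positivity)]
    apply le_of_eq
    field_simp
  · rw [norm_smul, h]
    apply le_of_eq
    ring

/-- Up to conjugation, row j of `lineProj c` is the inversion of c multiplied by the conjugate of
c_j. The total error of c is therefore weighted by the share of the entry v_j in the squared norm of
v, a gain available only for single rows. -/
theorem sum_norm_sq_lineProj_sub_le_of_ne {c v : Fin d → ℂ} (hc : 0 < ∑ i, ‖c i‖ ^ 2)
    (hv : 0 < ∑ i, ‖v i‖ ^ 2) (j : Fin d) :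
    ∑ t, ‖lineProj c j t - lineProj v j t‖ ^ 2
      ≤ 2 * (‖c j - v j‖ ^ 2 + ‖v j‖ ^ 2 / (∑ i, ‖v i‖ ^ 2) * ∑ i, ‖c i - v i‖ ^ 2)
        / ∑ i, ‖c i‖ ^ 2 := by
  let x : EuclideanSpace ℂ (Fin d) := WithLp.toLp 2 c
  let y : EuclideanSpace ℂ (Fin d) := WithLp.toLp 2 v
  have nx : ‖x‖ ^ 2 = ∑ i, ‖c i‖ ^ 2 := EuclideanSpace.norm_sq_eq x
  have ny : ‖y‖ ^ 2 = ∑ i, ‖v i‖ ^ 2 := EuclideanSpace.norm_sq_eq y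
  have nxy : ‖x - y‖ ^ 2 = ∑ i, ‖c i - v i‖ ^ 2 := EuclideanSpace.norm_sq_eq (x - y)
  have hx : x ≠ 0 := by rintro h; rw [← nx, h] at hc; simp at hc
  have hy : y ≠ 0 := by rintro h; rw [← ny, h] at hv; simp at hv
  have px := norm_pos_iff.2 hx
  have py := norm_pos_iff.2 hy
  have h := norm_smul_inversion_sub_le hx hy (star (c j)) (star (v j))
  have e : ∑ t, ‖lineProj c j t - lineProj v j t‖ ^ 2
      = ‖(((‖x‖ ^ 2 : ℝ) : ℂ)⁻¹ * star (c j)) • x - (((‖y‖ ^ 2 : ℝ) : ℂ)⁻¹ * star (v j)) • y‖ ^ 2 := by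
    rw [EuclideanSpace.norm_sq_eq]
    refine Finset.sum_congr rfl fun t _ => ?_
    rw [lineProj_apply, lineProj_apply, nx, ny, ← norm_star]
    congr 2
    simp [x, y]
    ring
  rw [e, ← nx, ← ny, ← nxy]
  rw [← star_sub, norm_star, norm_star] at h
  refine (pow_le_pow_left₀ (norm_nonneg _) h 2).trans ?_
  have e2 : 2 * (‖c j - v j‖ ^ 2 + ‖v j‖ ^ 2 / ‖y‖ ^ 2 * ‖x - y‖ ^ 2) / ‖x‖ ^ 2
      = 2 * ((‖c j - v j‖ / ‖x‖) ^ 2 + (‖v j‖ * (‖x - y‖ / (‖x‖ * ‖y‖))) ^ 2) := by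
    field_simp
  rw [e2]
  nlinarith [sq_nonneg (‖c j - v j‖ / ‖x‖ - ‖v j‖ * (‖x - y‖ / (‖x‖ * ‖y‖)))]

/-- A column of a pure state determines the state. -/
theorem lineProj_column {ψ : Fin d → ℂ} (hψ : ∑ j, ‖ψ j‖ ^ 2 = 1) {s : Fin d} (hs : ψ s ≠ 0) :
    lineProj (fun j => ψ j * star (ψ s)) = proj ψ := by
  ext j t
  have h : ∑ j, ‖ψ j * star (ψ s)‖ ^ 2 = ‖ψ s‖ ^ 2 := by
    simp only [norm_mul, norm_star, mul_pow, ← Finset.sum_mul, hψ, one_mul]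
  have h2 : ((‖ψ s‖ ^ 2 : ℝ) : ℂ) = ψ s * star (ψ s) := by
    push_cast; exact (Complex.mul_conj' _).symm
  have hs' : star (ψ s) ≠ 0 := star_ne_zero.2 hs
  rw [lineProj_apply, h, h2]
  simp only [star_mul, star_star]
  rw [proj, Matrix.vecMulVec_apply, Pi.star_apply]
  field_simp

/-- The rows of a pure state are stable under perturbations of a column with a large norm. -/
theorem sum_norm_sq_lineProj_sub_proj_le {c ψ : Fin d → ℂ} (hψ : ∑ j, ‖ψ j‖ ^ 2 = 1) {s : Fin d}
    {M D B : ℝ} (hM : ∀ j, ‖ψ j‖ ^ 2 ≤ M) (hM0 : 0 < M) (hM1 : M ≤ 1) (hMd : 1 ≤ M * d)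
    (hs : M / 4 ≤ ‖ψ s‖ ^ 2) (hD : 0 ≤ D) (hB : 0 ≤ B)
    (hj : ∀ j, ‖c j - ψ j * star (ψ s)‖ ^ 2 ≤ D + 2 * B)
    (hsum : ∑ j, ‖c j - ψ j * star (ψ s)‖ ^ 2 ≤ d * D + 2 * B) (hDs : d * D ≤ ‖ψ s‖ ^ 2 / 8)
    (j : Fin d) :
    ∑ t, ‖lineProj c j t - proj ψ j t‖ ^ 2 ≤ 64 * (d * D) + 256 * (B / M) := by
  have hp : 0 < ‖ψ s‖ ^ 2 := by linarith
  have hs0 : ψ s ≠ 0 := by intro h; simp [h] at hp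
  rw [← lineProj_column hψ hs0]
  have hdD : 0 ≤ d * D := by positivity
  -- For B ≥ M/64 the term 256 B/M already exceeds the trivial bound 4. Otherwise the error of c is
  -- at most a quarter of ‖v‖², which keeps c away from 0.
  rcases le_total (M / 64) B with h | h
  · refine (sum_norm_sq_lineProj_sub_le _ _ j).trans ?_
    have : 1 / 64 ≤ B / M := by rw [div_le_div_iff₀ (by norm_num) hM0]; linarith
    linarith
  · set v : Fin d → ℂ := fun j => ψ j * star (ψ s) with hv
    have nv : ∑ i, ‖v i‖ ^ 2 = ‖ψ s‖ ^ 2 := by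
      simp only [hv, norm_mul, norm_star, mul_pow, ← Finset.sum_mul, hψ, one_mul]
    have hΔ : ∑ i, ‖c i - v i‖ ^ 2 ≤ ‖ψ s‖ ^ 2 / 4 := by linarith
    have hc : ‖ψ s‖ ^ 2 / 4 ≤ ∑ i, ‖c i‖ ^ 2 := by
      have h1 : ∀ i, ‖v i‖ ^ 2 ≤ 2 * ‖c i‖ ^ 2 + 2 * ‖c i - v i‖ ^ 2 := by
        intro i
        have h2 : ‖v i‖ ≤ ‖c i‖ + ‖c i - v i‖ := by
          have := norm_sub_le (c i) (c i - v i); simpa using this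
        nlinarith [pow_le_pow_left₀ (norm_nonneg _) h2 2, sq_nonneg (‖c i‖ - ‖c i - v i‖)]
      have := Finset.sum_le_sum fun t (_ : t ∈ Finset.univ) => h1 t
      rw [Finset.sum_add_distrib, ← Finset.mul_sum, ← Finset.mul_sum, nv] at this
      linarith
    refine (sum_norm_sq_lineProj_sub_le_of_ne (by linarith) (by rw [nv]; exact hp) j).trans ?_
    have hvj : ‖v j‖ ^ 2 / (∑ i, ‖v i‖ ^ 2) = ‖ψ j‖ ^ 2 := by
      rw [nv, hv, norm_mul, norm_star, mul_pow]; field_simp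
    rw [hvj]
    have h3 : ‖ψ j‖ ^ 2 * ∑ i, ‖c i - v i‖ ^ 2 ≤ M * (d * D + 2 * B) :=
      mul_le_mul (hM j) hsum (Finset.sum_nonneg fun _ _ => by positivity) hM0.le
    -- This uses Md ≥ 1: the shared error D in the single entry j is no worse than its weighted
    -- total.
    have h4 : D ≤ M * (d * D) := by nlinarith
    have h5 : M * B ≤ B := by nlinarith
    have h6 : 2 * (‖c j - v j‖ ^ 2 + ‖ψ j‖ ^ 2 * ∑ i, ‖c i - v i‖ ^ 2)
        ≤ 4 * (M * (d * D)) + 8 * B := by linarith [hj j]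
    rw [div_le_iff₀ (by linarith)]
    have h7 : (64 * (d * D) + 256 * (B / M)) * (M / 16)
        ≤ (64 * (d * D) + 256 * (B / M)) * ∑ i, ‖c i‖ ^ 2 := by
      gcongr; linarith
    have h8 : (64 * (d * D) + 256 * (B / M)) * (M / 16) = 4 * (M * (d * D)) + 16 * B := by
      field_simp; ring
    linarith

end Perturbation

/-! ### The error of the tomography of a pure state -/

section Tomography

variable {d n : ℕ} {sel : (Fin d → ℝ) → Fin d} {ψ : Fin d → ℂ}

/-- The quadratic error of the frequencies in the basis measurement. -/
def basisErr (ψ : Fin d → ℂ) (a : Fin n → Fin d) : ℝ := ∑ j, (freq a j - ‖ψ j‖ ^ 2) ^ 2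

theorem basisErr_nonneg (ψ : Fin d → ℂ) (a : Fin n → Fin d) : 0 ≤ basisErr ψ a :=
  Finset.sum_nonneg fun _ _ => sq_nonneg _

theorem offErr_nonneg (ψ : Fin d → ℂ) (s : Fin d)
    (b : {j : Fin d // j ≠ s} → (Fin n → Bool) × (Fin n → Bool)) : 0 ≤ offErr ψ s b :=
  Finset.sum_nonneg fun _ _ => by positivity

/-- The error u - p of ρ̂_ss is kept apart from the rest because it is common to all entries of the
column, whereas the other errors are specific to j and their squares sum well. -/
theorem norm_sq_entry_error_le {z : ℂ} {p q u v x y : ℝ} {P Q : ℝ} (hP : P = (p + q) / 2 + z.re)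
    (hQ : Q = (p + q) / 2 + z.im) :
    ‖(x : ℂ) + Complex.I * (y : ℂ) - (1 + Complex.I) / 2 * (u : ℂ)
        - (1 + Complex.I) / 2 * (v : ℂ) - z‖ ^ 2
      ≤ (u - p) ^ 2 + 2 * ((2 * (x - P) ^ 2 + 2 * (y - Q) ^ 2) + (v - q) ^ 2) := by
  have h2 : (1 + Complex.I) / 2 = (⟨1 / 2, 1 / 2⟩ : ℂ) := by
    apply Complex.ext <;> simp
  have e : ‖(x : ℂ) + Complex.I * (y : ℂ) - (1 + Complex.I) / 2 * (u : ℂ)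
        - (1 + Complex.I) / 2 * (v : ℂ) - z‖ ^ 2
      = ((x - P) - ((u - p) + (v - q)) / 2) ^ 2 + ((y - Q) - ((u - p) + (v - q)) / 2) ^ 2 := by
    rw [h2, Complex.sq_norm, Complex.normSq_apply, hP, hQ]
    simp
    ring
  rw [e]
  nlinarith [sq_nonneg ((x - P) - (v - q) / 2 + (u - p) / 2), sq_nonneg ((x - P) + (v - q) / 2),
    sq_nonneg ((y - Q) - (v - q) / 2 + (u - p) / 2), sq_nonneg ((y - Q) + (v - q) / 2)]

theorem exists_columnEst_error (ψ : Fin d → ℂ) (a : Fin n → Fin d)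
    (b : {j : Fin d // j ≠ sel (freq a)} → (Fin n → Bool) × (Fin n → Bool)) :
    ∃ g : Fin d → ℝ, (∀ j, 0 ≤ g j) ∧ ∑ j, g j ≤ offErr ψ (sel (freq a)) b + basisErr ψ a ∧
      ∀ j, ‖columnEst (⟨a, b⟩ : StateRecord d n sel) j - ψ j * star (ψ (sel (freq a)))‖ ^ 2
        ≤ (freq a (sel (freq a)) - ‖ψ (sel (freq a))‖ ^ 2) ^ 2 + 2 * g j := by
  let h : Fin d → ℝ := fun j => if e : j ≠ sel (freq a) then
    (2 * (freq (b ⟨j, e⟩).1 true - born (proj ψ) (effP (sel (freq a)) j)) ^ 2 +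
      2 * (freq (b ⟨j, e⟩).2 true - born (proj ψ) (effQ (sel (freq a)) j)) ^ 2) else 0
  have hh : ∑ j, h j = offErr ψ (sel (freq a)) b := by
    rw [← Fintype.sum_subtype_add_sum_subtype (fun j : Fin d => j ≠ sel (freq a)) h]
    have h0 : ∑ j : {j : Fin d // ¬ j ≠ sel (freq a)}, h j.1 = 0 :=
      Finset.sum_eq_zero fun j _ => by simp only [h, dif_neg j.2]
    rw [h0, add_zero, offErr]
    exact Finset.sum_congr rfl fun j _ => by simp only [h, dif_pos j.2]
  refine ⟨fun j => h j + (freq a j - ‖ψ j‖ ^ 2) ^ 2, fun j => ?_, ?_, fun j => ?_⟩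
  · have : 0 ≤ h j := by simp only [h]; split_ifs <;> positivity
    positivity
  · rw [Finset.sum_add_distrib, hh]; rfl
  · beta_reduce
    by_cases e : j = sel (freq a)
    · have h0 : h j = 0 := by simp [h, e]
      have h1 : columnEst (⟨a, b⟩ : StateRecord d n sel) j = (freq a (sel (freq a)) : ℂ) := by
        simp only [columnEst]; rw [dif_neg (not_not.2 e)]
      have h2 : ψ j * star (ψ (sel (freq a))) = ((‖ψ (sel (freq a))‖ ^ 2 : ℝ) : ℂ) := by
        rw [e]; push_cast; exact Complex.mul_conj' _
      rw [h1, h2, h0, ← Complex.ofReal_sub, Complex.norm_real, Real.norm_eq_abs, sq_abs]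
      nlinarith [sq_nonneg (freq a j - ‖ψ j‖ ^ 2)]
    · have h0 : h j = (2 * (freq (b ⟨j, e⟩).1 true - born (proj ψ) (effP (sel (freq a)) j)) ^ 2 +
          2 * (freq (b ⟨j, e⟩).2 true - born (proj ψ) (effQ (sel (freq a)) j)) ^ 2) := by
        simp only [h]; rw [dif_pos e]
      have h1 : columnEst (⟨a, b⟩ : StateRecord d n sel) j =
          (freq (b ⟨j, e⟩).1 true : ℂ) + Complex.I * (freq (b ⟨j, e⟩).2 true : ℂ)
            - (1 + Complex.I) / 2 * (freq a (sel (freq a)) : ℂ) - (1 + Complex.I) / 2 * (freq a j : ℂ) := by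
        simp only [columnEst]; rw [dif_pos e]
      rw [h1, h0]
      exact norm_sq_entry_error_le (born_effP ψ (sel (freq a)) j) (born_effQ ψ (sel (freq a)) j)

open Classical in
/-- The indicator of a basis measurement with an improbable index `s` of a large frequency, or with
a large relative error of the frequency of `s`, where `m` is a most probable index. -/
def badIndex (ψ : Fin d → ℂ) (m : Fin d) (a : Fin n → Fin d) (s : Fin d) : ℝ :=
  if ‖ψ s‖ ^ 2 < ‖ψ m‖ ^ 2 / 4 then (if freq a m ≤ freq a s then 1 else 0)
  else (if √(‖ψ s‖ ^ 2 / (8 * d)) < |freq a s - ‖ψ s‖ ^ 2| then 1 else 0)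

theorem badIndex_nonneg (ψ : Fin d → ℂ) (m : Fin d) (a : Fin n → Fin d) (s : Fin d) :
    0 ≤ badIndex ψ m a s := by
  rw [badIndex]; split_ifs <;> norm_num

/-- A bound for the quadratic error of every row of the estimated state. -/
def rowBound (ψ : Fin d → ℂ) (m : Fin d) (r : StateRecord d n sel) : ℝ :=
  64 * (d * basisErr ψ r.1) + 256 / ‖ψ m‖ ^ 2 * (offErr ψ (sel (freq r.1)) r.2 + basisErr ψ r.1)
    + 4 * ∑ s, badIndex ψ m r.1 s

/-- The largest of d numbers with sum 1 is at least 1/d. -/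
theorem one_le_norm_sq_mul (hψ : ∑ j, ‖ψ j‖ ^ 2 = 1) {m : Fin d}
    (hm : ∀ j, ‖ψ j‖ ^ 2 ≤ ‖ψ m‖ ^ 2) : 1 ≤ ‖ψ m‖ ^ 2 * d := by
  have := Finset.sum_le_sum fun j (_ : j ∈ Finset.univ) => hm j
  rw [hψ] at this
  simpa [mul_comm] using this

/-- This is deterministic. If the selected index is bad, the trivial bound 4 is paid by the
`badIndex` term, summed over all s since the selected one depends on the data; otherwise the
perturbation bound applies. -/
theorem sum_norm_sq_stateEst_sub_le (hψ : ∑ j, ‖ψ j‖ ^ 2 = 1)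
    (hsel : ∀ (f : Fin d → ℝ) k, f k ≤ f (sel f)) {m : Fin d} (hm : ∀ j, ‖ψ j‖ ^ 2 ≤ ‖ψ m‖ ^ 2)
    (r : StateRecord d n sel) (j : Fin d) :
    ∑ t, ‖stateEst r j t - proj ψ j t‖ ^ 2 ≤ rowBound ψ m r := by
  obtain ⟨a, b⟩ := r
  have hMd := one_le_norm_sq_mul hψ hm
  have hM0 : 0 < ‖ψ m‖ ^ 2 := by
    by_contra h
    have h0 : ‖ψ m‖ ^ 2 = 0 := le_antisymm (not_lt.1 h) (by positivity)
    rw [h0] at hMd; norm_num at hMd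
  have hd : (0 : ℝ) < d := by
    by_contra h
    have h0 : (d : ℝ) = 0 := le_antisymm (not_lt.1 h) (by positivity)
    rw [h0] at hMd; norm_num at hMd
  have hM1 : ‖ψ m‖ ^ 2 ≤ 1 := by
    rw [← hψ]
    exact Finset.single_le_sum (f := fun i => ‖ψ i‖ ^ 2) (fun _ _ => by positivity)
      (Finset.mem_univ m)
  change ∑ t, ‖lineProj (columnEst (⟨a, b⟩ : StateRecord d n sel)) j t - proj ψ j t‖ ^ 2 ≤ _
  have h1 := basisErr_nonneg ψ a
  have h2 := offErr_nonneg ψ (sel (freq a)) b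
  have h3 : badIndex ψ m a (sel (freq a)) ≤ ∑ s, badIndex ψ m a s :=
    Finset.single_le_sum (fun s _ => badIndex_nonneg ψ m a s) (Finset.mem_univ _)
  have h4 := badIndex_nonneg ψ m a (sel (freq a))
  have hs1 : proj ψ = lineProj ψ := by
    rw [lineProj, trace_proj, hψ]; simp
  have triv := sum_norm_sq_lineProj_sub_le (columnEst (⟨a, b⟩ : StateRecord d n sel)) ψ j
  rw [← hs1] at triv
  have hpos : 0 ≤ 256 / ‖ψ m‖ ^ 2 * (offErr ψ (sel (freq a)) b + basisErr ψ a) := by positivity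
  have hpos' : 0 ≤ d * basisErr ψ a := by positivity
  simp only [rowBound]
  by_cases hbad : badIndex ψ m a (sel (freq a)) = 1
  · linarith
  · have hps : ‖ψ m‖ ^ 2 / 4 ≤ ‖ψ (sel (freq a))‖ ^ 2 := by
      by_contra h
      rw [badIndex, if_pos (not_le.1 h), if_pos (hsel _ _)] at hbad
      exact hbad rfl
    have hδ : |freq a (sel (freq a)) - ‖ψ (sel (freq a))‖ ^ 2|
        ≤ √(‖ψ (sel (freq a))‖ ^ 2 / (8 * d)) := by
      by_contra h
      rw [badIndex, if_neg (not_lt.2 hps), if_pos (not_le.1 h)] at hbad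
      exact hbad rfl
    have hδ2 : (freq a (sel (freq a)) - ‖ψ (sel (freq a))‖ ^ 2) ^ 2
        ≤ ‖ψ (sel (freq a))‖ ^ 2 / (8 * d) := by
      rw [← sq_abs, ← Real.sq_sqrt (show 0 ≤ ‖ψ (sel (freq a))‖ ^ 2 / (8 * d) by positivity)]
      exact pow_le_pow_left₀ (abs_nonneg _) hδ 2
    obtain ⟨g, hg0, hg, hc⟩ := exists_columnEst_error (sel := sel) ψ a b
    -- Since s depends on the data, its error is bounded by the sum over all indices, whose mean is
    -- still at most 1/n.
    have hD : (freq a (sel (freq a)) - ‖ψ (sel (freq a))‖ ^ 2) ^ 2 ≤ basisErr ψ a :=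
      Finset.single_le_sum (f := fun j => (freq a j - ‖ψ j‖ ^ 2) ^ 2)
        (fun _ _ => sq_nonneg _) (Finset.mem_univ _)
    refine (sum_norm_sq_lineProj_sub_proj_le hψ (s := sel (freq a)) hm hM0 hM1 hMd hps
      (D := (freq a (sel (freq a)) - ‖ψ (sel (freq a))‖ ^ 2) ^ 2)
      (B := offErr ψ (sel (freq a)) b + basisErr ψ a) (sq_nonneg _) (by linarith) ?_ ?_ ?_ j).trans ?_
    · intro j
      have : g j ≤ ∑ j, g j := Finset.single_le_sum (fun s _ => hg0 s) (Finset.mem_univ j)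
      linarith [hc j]
    · have := Finset.sum_le_sum fun j (_ : j ∈ Finset.univ) => hc j
      rw [Finset.sum_add_distrib, ← Finset.mul_sum] at this
      simp only [Finset.sum_const, Finset.card_univ, Fintype.card_fin, nsmul_eq_mul] at this
      linarith
    · calc _ ≤ d * (‖ψ (sel (freq a))‖ ^ 2 / (8 * d)) := by gcongr
        _ = _ := by field_simp
    · have : d * (freq a (sel (freq a)) - ‖ψ (sel (freq a))‖ ^ 2) ^ 2 ≤ d * basisErr ψ a := by gcongr
      have e : 256 * ((offErr ψ (sel (freq a)) b + basisErr ψ a) / ‖ψ m‖ ^ 2)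
          = 256 / ‖ψ m‖ ^ 2 * (offErr ψ (sel (freq a)) b + basisErr ψ a) := by ring
      linarith

theorem sum_basisErr_le (hψ : ∑ j, ‖ψ j‖ ^ 2 = 1) (hn : 0 < n) :
    ∑ a : Fin n → Fin d, (∏ i, ‖ψ (a i)‖ ^ 2) * basisErr ψ a ≤ 1 / n := by
  simp only [basisErr, Finset.mul_sum]
  rw [Finset.sum_comm, ← hψ, Finset.sum_div]
  exact Finset.sum_le_sum fun j _ => sum_iid_freq_sq_le (fun j => ‖ψ j‖ ^ 2) hψ hn j

/-- If |ψ_s|² < M/4, a tie or win of s over m has exponent nM/4 with M ≥ 1/d. Otherwise η² =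
|ψ_s|²/(8d) in the deviation bound gives exactly n/(32d), and |ψ_s|² ≥ 1/(4d) puts η in its range.
-/
theorem sum_badIndex_le (hψ : ∑ j, ‖ψ j‖ ^ 2 = 1) (hn : 0 < n) {m : Fin d}
    (hMd : 1 ≤ ‖ψ m‖ ^ 2 * d) (s : Fin d) :
    ∑ a : Fin n → Fin d, (∏ i, ‖ψ (a i)‖ ^ 2) * badIndex ψ m a s
      ≤ 2 * Real.exp (-(n / (32 * d))) := by
  classical
  have hd : (0 : ℝ) < d := by
    by_contra h
    have h0 : (d : ℝ) = 0 := le_antisymm (not_lt.1 h) (by positivity)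
    rw [h0] at hMd; norm_num at hMd
  have hM : 1 / (d : ℝ) ≤ ‖ψ m‖ ^ 2 := by rwa [div_le_iff₀ hd]
  have hd1 : 0 < 1 / (d : ℝ) := by positivity
  by_cases h : ‖ψ s‖ ^ 2 < ‖ψ m‖ ^ 2 / 4
  · simp only [badIndex, if_pos h]
    refine (sum_iid_freq_le_freq (fun j => ‖ψ j‖ ^ 2) (fun _ => by positivity) hψ hn h.le
      (by linarith)).trans ?_
    have h1 : Real.exp (-(n * (‖ψ m‖ ^ 2 / 4))) ≤ Real.exp (-(n / (32 * d))) := by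
      apply Real.exp_le_exp.2
      have : (n : ℝ) / (32 * d) = n * (1 / d / 32) := by field_simp
      rw [this]
      have : 1 / (d : ℝ) / 32 ≤ ‖ψ m‖ ^ 2 / 4 := by linarith
      have := mul_le_mul_of_nonneg_left this (Nat.cast_nonneg (α := ℝ) n)
      linarith
    linarith [Real.exp_pos (-(n / (32 * d) : ℝ))]
  · simp only [badIndex, if_neg h]
    have hp : 1 / (4 * d : ℝ) ≤ ‖ψ s‖ ^ 2 := by
      have : 1 / (4 * d : ℝ) = 1 / d / 4 := by field_simp
      rw [this]; linarith
    have hp0 : 0 < ‖ψ s‖ ^ 2 := lt_of_lt_of_le (by positivity) hp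
    refine (sum_iid_lt_abs_freq_sub (fun j => ‖ψ j‖ ^ 2) (fun _ => by positivity) hψ hn
      (Real.sqrt_nonneg _) hp0 ?_).trans ?_
    · refine Real.sqrt_le_iff.2 ⟨by positivity, ?_⟩
      rw [div_le_iff₀ (by positivity)]
      rw [div_le_iff₀ (by positivity)] at hp
      nlinarith
    · rw [Real.sq_sqrt (by positivity)]
      apply le_of_eq
      congr 3
      generalize ‖ψ s‖ ^ 2 = p at hp0
      field_simp
      norm_num

/-- The rows of a pure state are estimated with the mean square error `O(d / n)`, uniformly. -/
theorem sum_stateProb_mul_rowBound_le (hψ : ∑ j, ‖ψ j‖ ^ 2 = 1) (hn : 0 < n) (hdn : d ^ 2 ≤ n)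
    {m : Fin d} (hm : ∀ j, ‖ψ j‖ ^ 2 ≤ ‖ψ m‖ ^ 2) :
    ∑ r : StateRecord d n sel, stateProb (proj ψ) r * rowBound ψ m r ≤ 27000 * d / n := by
  have hn' : (0 : ℝ) < n := by positivity
  have hMd := one_le_norm_sq_mul hψ hm
  have hM0 : 0 < ‖ψ m‖ ^ 2 := by
    by_contra h
    have h0 : ‖ψ m‖ ^ 2 = 0 := le_antisymm (not_lt.1 h) (by positivity)
    rw [h0] at hMd; norm_num at hMd
  have hd : (0 : ℝ) < d := by
    by_contra h
    have h0 : (d : ℝ) = 0 := le_antisymm (not_lt.1 h) (by positivity)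
    rw [h0] at hMd; norm_num at hMd
  rw [sum_stateProb_mul]
  -- Conditionally on the basis outcomes, s is fixed and only `offErr` is random; the dependence on
  -- s is removed by |ψ_s|² ≤ |ψ_m|².
  have inner : ∀ a : Fin n → Fin d,
      ∑ b, offProb ψ (sel (freq a)) b * rowBound ψ m (⟨a, b⟩ : StateRecord d n sel)
        ≤ (64 * d + 256 / ‖ψ m‖ ^ 2) * basisErr ψ a
          + 256 / ‖ψ m‖ ^ 2 * (4 * (d * ‖ψ m‖ ^ 2 + 1) / n) + 4 * ∑ s, badIndex ψ m a s := by
    intro a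
    have e : ∀ b, offProb ψ (sel (freq a)) b * rowBound ψ m (⟨a, b⟩ : StateRecord d n sel)
        = offProb ψ (sel (freq a)) b * ((64 * d + 256 / ‖ψ m‖ ^ 2) * basisErr ψ a
            + 4 * ∑ s, badIndex ψ m a s)
          + 256 / ‖ψ m‖ ^ 2 * (offProb ψ (sel (freq a)) b * offErr ψ (sel (freq a)) b) := by
      intro b; simp only [rowBound]; ring
    simp only [e, Finset.sum_add_distrib, ← Finset.mul_sum, ← Finset.sum_mul, sum_offProb hψ]
    have h1 := sum_offProb_mul_offErr_le hψ hn (sel (freq a))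
    have h2 : 4 * (d * ‖ψ (sel (freq a))‖ ^ 2 + 1) / (n : ℝ) ≤ 4 * (d * ‖ψ m‖ ^ 2 + 1) / n := by
      have := mul_le_mul_of_nonneg_left (hm (sel (freq a))) hd.le
      apply div_le_div_of_nonneg_right _ hn'.le
      linarith
    have h3 := mul_le_mul_of_nonneg_left (h1.trans h2) (show 0 ≤ 256 / ‖ψ m‖ ^ 2 by positivity)
    linarith
  have hw : ∀ a : Fin n → Fin d, 0 ≤ ∏ i, ‖ψ (a i)‖ ^ 2 := fun a =>
    Finset.prod_nonneg fun _ _ => by positivity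
  refine (Finset.sum_le_sum fun a _ => mul_le_mul_of_nonneg_left (inner a) (hw a)).trans ?_
  have e : ∀ a : Fin n → Fin d, (∏ i, ‖ψ (a i)‖ ^ 2) *
      ((64 * d + 256 / ‖ψ m‖ ^ 2) * basisErr ψ a
          + 256 / ‖ψ m‖ ^ 2 * (4 * (d * ‖ψ m‖ ^ 2 + 1) / n) + 4 * ∑ s, badIndex ψ m a s)
      = (64 * d + 256 / ‖ψ m‖ ^ 2) * ((∏ i, ‖ψ (a i)‖ ^ 2) * basisErr ψ a)
        + (∏ i, ‖ψ (a i)‖ ^ 2) * (256 / ‖ψ m‖ ^ 2 * (4 * (d * ‖ψ m‖ ^ 2 + 1) / n))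
        + 4 * ∑ s, (∏ i, ‖ψ (a i)‖ ^ 2) * badIndex ψ m a s := by
    intro a; rw [← Finset.mul_sum]; ring
  simp only [e, Finset.sum_add_distrib]
  rw [← Finset.mul_sum, ← Finset.sum_mul, ← Finset.mul_sum, sum_iid (fun j => ‖ψ j‖ ^ 2) hψ n,
    Finset.sum_comm]
  have b1 := mul_le_mul_of_nonneg_left (sum_basisErr_le hψ hn)
    (show 0 ≤ 64 * d + 256 / ‖ψ m‖ ^ 2 by positivity)
  have b2 : ∑ s, ∑ a : Fin n → Fin d, (∏ i, ‖ψ (a i)‖ ^ 2) * badIndex ψ m a s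
      ≤ d * (2 * Real.exp (-(n / (32 * d)))) := by
    have := Finset.sum_le_sum fun s (_ : s ∈ Finset.univ) => sum_badIndex_le hψ hn hMd s
    simpa using this
  have hinv : 1 / ‖ψ m‖ ^ 2 ≤ d := by rw [div_le_iff₀ hM0]; linarith
  have b3 : (64 * d + 256 / ‖ψ m‖ ^ 2) * (1 / n : ℝ) ≤ 320 * d / n := by
    have : 256 / ‖ψ m‖ ^ 2 = 256 * (1 / ‖ψ m‖ ^ 2) := by ring
    rw [mul_one_div, this]
    gcongr
    linarith
  have b4 : 256 / ‖ψ m‖ ^ 2 * (4 * (d * ‖ψ m‖ ^ 2 + 1) / n) ≤ 2048 * d / n := by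
    have : 256 / ‖ψ m‖ ^ 2 * (4 * (d * ‖ψ m‖ ^ 2 + 1) / n)
        = (1024 * d + 1024 * (1 / ‖ψ m‖ ^ 2)) / n := by
      generalize ‖ψ m‖ ^ 2 = M at hM0
      field_simp
      ring
    rw [this]
    gcongr
    linarith
  -- This is exp x ≥ x²/2 at x = n/(32d), with 2048 = 2 · 32²; the hypothesis d² ≤ n replaces n²/d²
  -- by n.
  have b5 : Real.exp (-(n / (32 * d) : ℝ)) ≤ 2048 / n := by
    have h1 := Real.quadratic_le_exp_of_nonneg (show 0 ≤ (n / (32 * d) : ℝ) by positivity)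
    have h2 : (n / (32 * d) : ℝ) ^ 2 / 2 ≤ Real.exp (n / (32 * d)) := by
      have : 0 ≤ (n / (32 * d) : ℝ) := by positivity
      linarith
    have h3 : (n : ℝ) / 2048 ≤ (n / (32 * d) : ℝ) ^ 2 / 2 := by
      have hdn' : (d : ℝ) ^ 2 ≤ n := by exact_mod_cast hdn
      rw [div_pow, div_div, div_le_div_iff₀ (by norm_num) (by positivity)]
      nlinarith
    rw [Real.exp_neg, inv_le_comm₀ (Real.exp_pos _) (by positivity), inv_div]
    linarith
  have b6 : 4 * (d * (2 * Real.exp (-(n / (32 * d) : ℝ)))) ≤ 16384 * d / n := by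
    have := mul_le_mul_of_nonneg_left b5 (show 0 ≤ 8 * (d : ℝ) by positivity)
    calc _ = 8 * d * Real.exp (-(n / (32 * d) : ℝ)) := by ring
      _ ≤ _ := this
      _ = _ := by ring
  have b7 : (320 * d / n + 2048 * d / n + 16384 * d / n : ℝ) ≤ 27000 * d / n := by
    rw [← add_div, ← add_div]
    gcongr
    linarith
  linarith

end Tomography

/-! ### The Hilbert-Schmidt norm and polar factors -/

section Polar

variable {d : ℕ}

theorem norm_sq_eq_sum (A : Mat d) : ‖A‖ ^ 2 = ∑ i, ∑ j, ‖A i j‖ ^ 2 := by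
  rw [Matrix.frobenius_norm_def]
  have h : 0 ≤ ∑ i, ∑ j, ‖A i j‖ ^ (2 : ℝ) := by positivity
  rw [← Real.rpow_natCast, ← Real.rpow_mul h]
  norm_num

theorem norm_sq_eq_trace (A : Mat d) : ((‖A‖ ^ 2 : ℝ) : ℂ) = Matrix.trace (Aᴴ * A) := by
  rw [norm_sq_eq_sum, Finset.sum_comm]
  simp only [Matrix.trace, Matrix.diag, Matrix.mul_apply, Matrix.conjTranspose_apply]
  push_cast
  refine Finset.sum_congr rfl fun i _ => Finset.sum_congr rfl fun j _ => ?_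
  exact (Complex.conj_mul' _).symm

theorem norm_unitary_mul {U : Mat d} (hU : U ∈ Matrix.unitaryGroup (Fin d) ℂ) (A : Mat d) :
    ‖U * A‖ = ‖A‖ := by
  have h : ‖U * A‖ ^ 2 = ‖A‖ ^ 2 := by
    have : ((‖U * A‖ ^ 2 : ℝ) : ℂ) = ((‖A‖ ^ 2 : ℝ) : ℂ) := by
      have hU' : Uᴴ * U = 1 := Matrix.mem_unitaryGroup_iff'.1 hU
      rw [norm_sq_eq_trace, norm_sq_eq_trace, Matrix.conjTranspose_mul, Matrix.mul_assoc,
        ← Matrix.mul_assoc Uᴴ, hU', Matrix.one_mul]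
    exact_mod_cast this
  exact (pow_left_inj₀ (norm_nonneg _) (norm_nonneg _) two_ne_zero).1 h

theorem norm_mul_unitary {U : Mat d} (hU : U ∈ Matrix.unitaryGroup (Fin d) ℂ) (A : Mat d) :
    ‖A * U‖ = ‖A‖ := by
  have hU' : Uᴴ ∈ Matrix.unitaryGroup (Fin d) ℂ := Unitary.star_mem hU
  rw [← Matrix.frobenius_norm_conjTranspose, Matrix.conjTranspose_mul, norm_unitary_mul hU',
    Matrix.frobenius_norm_conjTranspose]

theorem norm_sq_unitary {U : Mat d} (hU : U ∈ Matrix.unitaryGroup (Fin d) ℂ) : ‖U‖ ^ 2 = d := by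
  rw [← mul_one U, norm_unitary_mul hU, norm_sq_eq_sum]
  simp [Matrix.one_apply, apply_ite]

theorem sum_norm_sq_column {U : Mat d} (hU : U ∈ Matrix.unitaryGroup (Fin d) ℂ) (k : Fin d) :
    ∑ i, ‖U i k‖ ^ 2 = 1 := by
  have h : (Uᴴ * U) k k = (1 : Mat d) k k := by
    rw [show Uᴴ * U = 1 from Matrix.mem_unitaryGroup_iff'.1 hU]
  rw [Matrix.mul_apply, Matrix.one_apply_eq] at h
  have : ((∑ i, ‖U i k‖ ^ 2 : ℝ) : ℂ) = 1 := by
    rw [← h]; push_cast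
    refine Finset.sum_congr rfl fun i _ => ?_
    rw [Matrix.conjTranspose_apply]
    exact (Complex.conj_mul' _).symm
  exact_mod_cast this

/-- Column by column, the two terms on the right have norms σ_k and α, so their distance is at least
|σ_k - α|, which the identity attains. -/
theorem norm_diagonal_sub_smul_one_le {σ : Fin d → ℝ} (hσ : ∀ i, 0 ≤ σ i) {W : Mat d}
    (hW : W ∈ Matrix.unitaryGroup (Fin d) ℂ) {α : ℝ} (hα : 0 ≤ α) :
    ‖Matrix.diagonal (fun i => (σ i : ℂ)) - (α : ℂ) • (1 : Mat d)‖
      ≤ ‖Matrix.diagonal (fun i => (σ i : ℂ)) - (α : ℂ) • W‖ := by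
  refine (pow_le_pow_iff_left₀ (norm_nonneg _) (norm_nonneg _) two_ne_zero).1 ?_
  rw [norm_sq_eq_sum, norm_sq_eq_sum, Finset.sum_comm,
    Finset.sum_comm (f := fun i j => ‖(Matrix.diagonal (fun i => (σ i : ℂ)) - (α : ℂ) • W) i j‖ ^ 2)]
  refine Finset.sum_le_sum fun k _ => ?_
  let x : EuclideanSpace ℂ (Fin d) := WithLp.toLp 2 fun i => if i = k then (σ k : ℂ) else 0
  let y : EuclideanSpace ℂ (Fin d) := WithLp.toLp 2 fun i => (α : ℂ) * W i k
  have nx : ‖x‖ = σ k := by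
    have : ‖x‖ ^ 2 = σ k ^ 2 := by
      rw [EuclideanSpace.norm_sq_eq, Finset.sum_eq_single k]
      · simp [x]
      · intro i _ hi; simp [x, hi]
      · simp
    exact (pow_left_inj₀ (norm_nonneg _) (hσ k) two_ne_zero).1 this
  have ny : ‖y‖ = α := by
    have : ‖y‖ ^ 2 = α ^ 2 := by
      rw [EuclideanSpace.norm_sq_eq]
      simp only [y, norm_mul, mul_pow, ← Finset.mul_sum, sum_norm_sq_column hW]
      simp
    exact (pow_left_inj₀ (norm_nonneg _) hα two_ne_zero).1 this
  have nxy : ‖x - y‖ ^ 2 = ∑ i, ‖(Matrix.diagonal (fun i => (σ i : ℂ)) - (α : ℂ) • W) i k‖ ^ 2 := by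
    rw [EuclideanSpace.norm_sq_eq]
    refine Finset.sum_congr rfl fun i _ => ?_
    by_cases h : i = k
    · subst h; simp [x, y]
    · simp [x, y, h]
  have lhs : ∑ i, ‖(Matrix.diagonal (fun i => (σ i : ℂ)) - (α : ℂ) • (1 : Mat d)) i k‖ ^ 2
      = (σ k - α) ^ 2 := by
    rw [Finset.sum_eq_single k]
    · simp [← Complex.ofReal_sub]
    · intro i _ hi; simp [hi]
    · simp
  rw [lhs, ← nxy, ← sq_abs, ← nx, ← ny]
  exact pow_le_pow_left₀ (abs_nonneg _) (abs_norm_sub_norm_le x y) 2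

/-- The unitary polar factor of a matrix is the closest unitary, at every scale. -/
theorem IsPolarUnitary.norm_sub_smul_le {S G V : Mat d} (h : IsPolarUnitary S G)
    (hV : V ∈ Matrix.unitaryGroup (Fin d) ℂ) {α : ℝ} (hα : 0 ≤ α) :
    ‖S - (α : ℂ) • G‖ ≤ ‖S - (α : ℂ) • V‖ := by
  obtain ⟨U₁, h₁, U₂, h₂, σ, hσ, rfl, rfl⟩ := h
  have e₁ : U₁ * U₁ᴴ = 1 := Matrix.mem_unitaryGroup_iff.1 h₁
  have e₂ : U₂ᴴ * U₂ = 1 := Matrix.mem_unitaryGroup_iff'.1 h₂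
  have hW : U₁ᴴ * V * U₂ᴴ ∈ Matrix.unitaryGroup (Fin d) ℂ :=
    mul_mem (mul_mem (Unitary.star_mem h₁) hV) (Unitary.star_mem h₂)
  have hVW : V = U₁ * (U₁ᴴ * V * U₂ᴴ) * U₂ := by
    rw [Matrix.mul_assoc, Matrix.mul_assoc, e₂, Matrix.mul_one, ← Matrix.mul_assoc, e₁,
      Matrix.one_mul]
  have f₁ : U₁ * Matrix.diagonal (fun i => (σ i : ℂ)) * U₂ - (α : ℂ) • (U₁ * U₂)
      = U₁ * (Matrix.diagonal (fun i => (σ i : ℂ)) - (α : ℂ) • (1 : Mat d)) * U₂ := by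
    simp [Matrix.mul_sub, Matrix.sub_mul]
  have f₂ : U₁ * Matrix.diagonal (fun i => (σ i : ℂ)) * U₂ - (α : ℂ) • V
      = U₁ * (Matrix.diagonal (fun i => (σ i : ℂ)) - (α : ℂ) • (U₁ᴴ * V * U₂ᴴ)) * U₂ := by
    rw [Matrix.mul_sub, Matrix.sub_mul, Matrix.mul_smul, Matrix.smul_mul, ← hVW]
  rw [f₁, f₂, norm_mul_unitary h₂, norm_mul_unitary h₂, norm_unitary_mul h₁, norm_unitary_mul h₁]
  exact norm_diagonal_sub_smul_one_le hσ hW hα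

theorem IsPolarUnitary.mem_unitaryGroup {S G : Mat d} (h : IsPolarUnitary S G) :
    G ∈ Matrix.unitaryGroup (Fin d) ℂ := by
  obtain ⟨U₁, h₁, U₂, h₂, σ, -, -, rfl⟩ := h
  exact mul_mem h₁ h₂

/-- Both α G and α V are within ‖S - α V‖ of S, by minimality of G. No lower bound on the singular
values of S is needed. -/
theorem IsPolarUnitary.mul_norm_sub_le {S G V : Mat d} (h : IsPolarUnitary S G)
    (hV : V ∈ Matrix.unitaryGroup (Fin d) ℂ) {α : ℝ} (hα : 0 ≤ α) :
    α * ‖G - V‖ ≤ 2 * ‖S - (α : ℂ) • V‖ := by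
  have h1 : ‖(α : ℂ) • (G - V)‖ = α * ‖G - V‖ := by
    rw [norm_smul, Complex.norm_real, Real.norm_of_nonneg hα]
  have h2 : (α : ℂ) • (G - V) = (S - (α : ℂ) • V) - (S - (α : ℂ) • G) := by
    rw [smul_sub]; abel
  rw [← h1, h2]
  linarith [norm_sub_le (S - (α : ℂ) • V) (S - (α : ℂ) • G), h.norm_sub_smul_le hV hα]

end Polar

/-! ### Reconstruction of the gate -/

section Reconstruction

variable {d n : ℕ} [NeZero d] {sel : Probe d → (Fin d → ℝ) → Fin d}

theorem coeffB_apply (m p : Fin d × Fin d) (a q t : Fin d) :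
    coeffB m p (a, 0) (q, t) = if m = (0, t) then (if p = (a, q) then 1 else 0) else 0 := by
  obtain ⟨m₁, m₂⟩ := m
  obtain ⟨p₁, p₂⟩ := p
  simp only [coeffB, natBasis, Matrix.conjTranspose_single, star_one]
  by_cases h₁ : m₁ = 0
  · subst h₁
    rw [Matrix.single_mul_single_same]
    by_cases h₂ : m₂ = t
    · subst h₂
      rw [Matrix.single_mul_single_same]
      simp [Matrix.single_apply, eq_comm]
    · rw [Matrix.single_mul_single_of_ne _ _ _ _ h₂]
      simp [h₂]
  · rw [Matrix.single_mul_single_of_ne _ _ _ _ (Ne.symm h₁)]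
    simp [h₁]

/-- The contraction with B only rearranges entries: the row (a, 0) of D̂ lists the a-th rows of the
estimates of ε(|1⟩⟨k|). -/
theorem matDEst_apply (ω : Record d n sel) (a q t : Fin d) :
    matDEst ω (a, 0) (q, t) = channelEst ω t a q := by
  simp only [matDEst, coeffB_apply]
  rw [Finset.sum_eq_single (0, t), Finset.sum_eq_single (a, q)]
  · simp [lambdaEst]
  · intro p _ hp; simp [hp]
  · simp
  · intro m _ hm; simp [hm]
  · simp

theorem rowNorm_eq (ω : Record d n sel) (a : Fin d) : rowNorm ω a = ‖matSEst ω a‖ := by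
  have h : ∑ k, ‖matDEst ω (a, 0) k‖ ^ 2 = ‖matSEst ω a‖ ^ 2 := by
    rw [norm_sq_eq_sum, Fintype.sum_prod_type, Finset.sum_comm]
    simp only [matSEst, norm_star]
  rw [rowNorm, h, Real.sqrt_sq (norm_nonneg _)]

theorem norm_sq_matSEst_sub (ω : Record d n sel) (U : Mat d) (a : Fin d) :
    ‖matSEst ω a - star (U a 0) • Uᵀ‖ ^ 2
      = ∑ k, ∑ q, ‖channelEst ω k a q - U a 0 * star (U q k)‖ ^ 2 := by
  rw [norm_sq_eq_sum]
  refine Finset.sum_congr rfl fun t _ => Finset.sum_congr rfl fun q _ => ?_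
  rw [← norm_star (channelEst ω t a q - U a 0 * star (U q t)), Matrix.sub_apply, Matrix.smul_apply,
    Matrix.transpose_apply, matSEst, matDEst_apply, star_sub, star_mul, star_star, smul_eq_mul,
    mul_comm (U q t)]

/-- The accuracy of the reconstruction, if the row `a` of the estimate of `ε(|1⟩⟨k|)` is close to
the row `a` of `ε(|1⟩⟨k|)` for all `a`. -/
theorem norm_sq_gateEst_sub_le {U : Mat d} (hU : U ∈ Matrix.unitaryGroup (Fin d) ℂ)
    {ω : Record d n sel} {W : ℝ}
    (hW : ∀ a, ∑ k, ∑ q, ‖channelEst ω k a q - U a 0 * star (U q k)‖ ^ 2 ≤ W)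
    {j : Fin d} {G : Mat d} (h : IsReconstruction ω j G) :
    ‖gateEst U j G - U‖ ^ 2 ≤ 64 * (d * W) ∧ ‖gateEst U j G - U‖ ^ 2 ≤ 4 * d := by
  obtain ⟨hmax, hG⟩ := h
  have hd : (0 : ℝ) < d := by exact_mod_cast Nat.pos_of_ne_zero (NeZero.ne d)
  have hW0 : 0 ≤ W := le_trans (Finset.sum_nonneg fun _ _ => Finset.sum_nonneg fun _ _ =>
    by positivity) (hW 0)
  have hS : ∀ a, ‖matSEst ω a - star (U a 0) • Uᵀ‖ ≤ √W := fun a => by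
    refine Real.le_sqrt_of_sq_le ?_
    rw [norm_sq_matSEst_sub]; exact hW a
  set e : ℂ := Complex.exp (Complex.arg (U j 0) * Complex.I) with he
  have hne : ‖e‖ = 1 := Complex.norm_exp_ofReal_mul_I _
  have hes : e * star e = 1 := by
    have := Complex.mul_conj' e
    rw [hne] at this
    simpa using this
  have hUj : U j 0 = (‖U j 0‖ : ℂ) * e := (Complex.norm_mul_exp_arg_mul_I _).symm
  have hUT : Uᵀ ∈ Matrix.unitaryGroup (Fin d) ℂ := by
    rw [Matrix.mem_unitaryGroup_iff]
    have h1 : Uᴴ * U = 1 := Matrix.mem_unitaryGroup_iff'.1 hU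
    have h2 := congrArg Matrix.transpose h1
    rw [Matrix.transpose_mul, Matrix.transpose_one] at h2
    exact h2
  have hV : star e • Uᵀ ∈ Matrix.unitaryGroup (Fin d) ℂ := by
    rw [Matrix.mem_unitaryGroup_iff, star_smul, star_star, Matrix.smul_mul, Matrix.mul_smul,
      Matrix.mem_unitaryGroup_iff.1 hUT, smul_smul, mul_comm, hes, one_smul]
  have hgate : ‖gateEst U j G - U‖ = ‖G - star e • Uᵀ‖ := by
    have : gateEst U j G - U = e • (G - star e • Uᵀ)ᵀ := by
      rw [Matrix.transpose_sub, Matrix.transpose_smul, Matrix.transpose_transpose, smul_sub,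
        smul_smul, hes, one_smul]
      rfl
    rw [this, norm_smul, hne, one_mul, Matrix.frobenius_norm_transpose]
  have hnG := norm_sq_unitary hG.mem_unitaryGroup
  have hnV := norm_sq_unitary hV
  have htriv : ‖G - star e • Uᵀ‖ ^ 2 ≤ 4 * d := by
    have h1 := pow_le_pow_left₀ (norm_nonneg _) (norm_sub_le G (star e • Uᵀ)) 2
    nlinarith [sq_nonneg (‖G‖ - ‖star e • Uᵀ‖)]
  rw [hgate]
  refine ⟨?_, htriv⟩
  -- For W ≥ 1/16 the claim 64 d W follows from the trivial bound 4d.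
  rcases le_total W (1 / 16) with hWs | hWl
  swap
  · nlinarith
  have hα : matSEst ω j - star (U j 0) • Uᵀ = matSEst ω j - (‖U j 0‖ : ℂ) • (star e • Uᵀ) := by
    rw [smul_smul]
    congr 2
    conv_lhs => rw [hUj]
    rw [star_mul, mul_comm]
    congr 1
    exact Complex.conj_ofReal _
  have hpol := hG.mul_norm_sub_le hV (norm_nonneg (U j 0))
  rw [← hα] at hpol
  have hsqrtW : √W ≤ 1 / 4 := Real.sqrt_le_iff.2 ⟨by norm_num, by linarith⟩
  obtain ⟨a, ha⟩ : ∃ a, 1 / (d : ℝ) ≤ ‖U a 0‖ ^ 2 := by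
    by_contra! hlt
    have := Finset.sum_lt_sum_of_nonempty (s := (Finset.univ : Finset (Fin d)))
      ⟨0, Finset.mem_univ _⟩ fun a _ => hlt a
    rw [sum_norm_sq_column hU] at this
    simp [hd.ne'] at this
  have hnU : ∀ b, ‖star (U b 0) • Uᵀ‖ = ‖U b 0‖ * √d := by
    intro b
    rw [norm_smul, norm_star, Matrix.frobenius_norm_transpose, ← norm_sq_unitary hU,
      Real.sqrt_sq (norm_nonneg _)]
  have hsd : √(d : ℝ) ^ 2 = d := Real.sq_sqrt hd.le
  have ha1 : 1 ≤ ‖U a 0‖ * √d := by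
    rw [div_le_iff₀ hd] at ha
    by_contra! hlt
    nlinarith [show 0 ≤ ‖U a 0‖ * √d by positivity]
  have hrow : ‖matSEst ω a‖ ≤ ‖matSEst ω j‖ := by
    rw [← rowNorm_eq, ← rowNorm_eq]; exact hmax a
  -- The exact row a has norm at least 1. Passing to its estimate, to the maximal row j, and back to
  -- the exact row j costs 2√W ≤ 1/2.
  have hja : 1 / 2 ≤ ‖U j 0‖ * √d := by
    have h1 := norm_sub_norm_le (star (U a 0) • Uᵀ) (matSEst ω a)
    have h2 := norm_sub_norm_le (matSEst ω j) (star (U j 0) • Uᵀ)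
    rw [norm_sub_rev, hnU] at h1
    rw [hnU] at h2
    linarith [hS a, hS j]
  have hfin : ‖G - star e • Uᵀ‖ ≤ 4 * √d * √W := by
    have h1 : 1 / 2 * ‖G - star e • Uᵀ‖ ≤ ‖U j 0‖ * √d * ‖G - star e • Uᵀ‖ := by gcongr
    have h2 : ‖U j 0‖ * √d * ‖G - star e • Uᵀ‖ ≤ √d * (2 * √W) := by
      rw [mul_comm ‖U j 0‖ (√d), mul_assoc]
      exact mul_le_mul_of_nonneg_left (hpol.trans (by linarith [hS j])) (Real.sqrt_nonneg _)
    linarith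
  calc ‖G - star e • Uᵀ‖ ^ 2 ≤ (4 * √d * √W) ^ 2 := pow_le_pow_left₀ (norm_nonneg _) hfin 2
    _ = 16 * (d * W) := by rw [mul_pow, mul_pow, hsd, Real.sq_sqrt hW0]; ring
    _ ≤ _ := by nlinarith [mul_nonneg hd.le hW0]

end Reconstruction

/-! ### The error of the estimate of the channel -/

theorem mul_proj_mul_conjTranspose {d : ℕ} (U : Mat d) (v : Fin d → ℂ) :
    U * proj v * Uᴴ = proj (U *ᵥ v) := by
  rw [proj, proj, Matrix.mul_vecMulVec, Matrix.vecMulVec_mul, Matrix.star_mulVec]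

theorem sum_norm_sq_mulVec {d : ℕ} {U : Mat d} (hU : U ∈ Matrix.unitaryGroup (Fin d) ℂ) (v : Fin d → ℂ) :
    ∑ j, ‖(U *ᵥ v) j‖ ^ 2 = ∑ j, ‖v j‖ ^ 2 := by
  have h : Matrix.trace (proj (U *ᵥ v)) = Matrix.trace (proj v) := by
    rw [← mul_proj_mul_conjTranspose, Matrix.trace_mul_comm, ← Matrix.mul_assoc,
      show Uᴴ * U = 1 from Matrix.mem_unitaryGroup_iff'.1 hU, Matrix.one_mul]
  rw [trace_proj, trace_proj] at h
  exact_mod_cast h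

theorem proj_smul_apply {d : ℕ} (z : ℂ) (v : Fin d → ℂ) (a q : Fin d) :
    proj (z • v) a q = z * star z * (v a * star (v q)) := by
  simp [proj, Matrix.vecMulVec_apply]; ring

theorem inv_sqrt_two_mul_star : ((1 / √2 : ℝ) : ℂ) * star ((1 / √2 : ℝ) : ℂ) = 1 / 2 := by
  have : ((1 / √2 : ℝ) : ℂ) * star ((1 / √2 : ℝ) : ℂ) = (((1 / √2) * (1 / √2) : ℝ) : ℂ) := by
    rw [Complex.ofReal_mul]; congr 1; exact Complex.conj_ofReal _
  rw [this, div_mul_div_comm, Real.mul_self_sqrt (by norm_num)]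
  norm_num

section Channel

variable {d n : ℕ} [NeZero d] {sel : Probe d → (Fin d → ℝ) → Fin d} {U : Mat d}

/-- The vector of the output state for a probe state. -/
def outKet (U : Mat d) (x : Probe d) : Fin d → ℂ := U *ᵥ probeKet x

theorem outState_eq (U : Mat d) (x : Probe d) : outState U x = proj (outKet U x) :=
  mul_proj_mul_conjTranspose U _

theorem sum_norm_sq_superposition {k : Fin d} (hk : k ≠ 0) {z : ℂ} (hz : ‖z‖ = 1) :
    ∑ j, ‖(((1 / √2 : ℝ) : ℂ) • (ket 0 + z • ket k) : Fin d → ℂ) j‖ ^ 2 = 1 := by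
  have h2 : ‖((1 / √2 : ℝ) : ℂ)‖ ^ 2 = 1 / 2 := by
    rw [Complex.norm_real, Real.norm_eq_abs, sq_abs, div_pow, Real.sq_sqrt (by norm_num)]
    norm_num
  have e : ∀ j, ‖(((1 / √2 : ℝ) : ℂ) • (ket 0 + z • ket k) : Fin d → ℂ) j‖ ^ 2
      = (if j = 0 then 1 / 2 else 0) + if j = k then 1 / 2 else 0 := by
    intro j
    rw [Pi.smul_apply, smul_eq_mul, norm_mul, mul_pow, h2, Pi.add_apply, Pi.smul_apply, ket, ket]
    by_cases h0 : j = 0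
    · subst h0; simp [hk.symm]
    · by_cases h1 : j = k
      · subst h1; simp [hk, hz]
      · simp [h0, h1]
  simp only [e, Finset.sum_add_distrib]
  norm_num

theorem sum_norm_sq_probeKet (x : Probe d) : ∑ j, ‖probeKet x j‖ ^ 2 = 1 := by
  rcases x with k | k | k
  · simp only [probeKet, ket]
    rw [Finset.sum_eq_single k]
    · simp
    · intro j _ hj; simp [hj]
    · simp
  · have := sum_norm_sq_superposition k.2 (z := 1) (by simp)
    rwa [one_smul] at this
  · exact sum_norm_sq_superposition k.2 Complex.norm_I

theorem sum_norm_sq_outKet (hU : U ∈ Matrix.unitaryGroup (Fin d) ℂ) (x : Probe d) :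
    ∑ j, ‖outKet U x j‖ ^ 2 = 1 := by
  rw [outKet, sum_norm_sq_mulVec hU, sum_norm_sq_probeKet]

theorem proj_outKet_ket (U : Mat d) (k a q : Fin d) :
    proj (outKet U (Sum.inl k)) a q = U a k * star (U q k) := by
  simp [outKet, probeKet, ket, proj, Matrix.vecMulVec_apply]

theorem proj_outKet_plus (U : Mat d) (k : {k : Fin d // k ≠ 0}) (a q : Fin d) :
    proj (outKet U (Sum.inr (Sum.inl k))) a q
      = 1 / 2 * ((U a 0 + U a k) * star (U q 0 + U q k)) := by
  rw [outKet, probeKet, Matrix.mulVec_smul, proj_smul_apply, inv_sqrt_two_mul_star, Matrix.mulVec_add]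
  simp [ket]

theorem proj_outKet_minus (U : Mat d) (k : {k : Fin d // k ≠ 0}) (a q : Fin d) :
    proj (outKet U (Sum.inr (Sum.inr k))) a q
      = 1 / 2 * ((U a 0 + Complex.I * U a k) * star (U q 0 + Complex.I * U q k)) := by
  rw [outKet, probeKet, Matrix.mulVec_smul, proj_smul_apply, inv_sqrt_two_mul_star, Matrix.mulVec_add,
    Matrix.mulVec_smul]
  simp [ket]

/-- The reconstruction of `ε(|1⟩⟨k|)` from the exact output states. -/
theorem proj_outKet_combination (U : Mat d) (k : {k : Fin d // k ≠ 0}) (a q : Fin d) :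
    proj (outKet U (Sum.inr (Sum.inl k))) a q
      + Complex.I * proj (outKet U (Sum.inr (Sum.inr k))) a q
      - (1 + Complex.I) / 2 * proj (outKet U (Sum.inl 0)) a q
      - (1 + Complex.I) / 2 * proj (outKet U (Sum.inl k.1)) a q = U a 0 * star (U q k) := by
  rw [proj_outKet_plus, proj_outKet_minus, proj_outKet_ket, proj_outKet_ket]
  have hI : star Complex.I = -Complex.I := Complex.conj_I
  simp only [star_add, star_mul, hI]
  linear_combination ((U a k.1 * star (U q 0)) / 2 - U a 0 * star (U q k.1) / 2
    - Complex.I * U a k.1 * star (U q k.1) / 2) * Complex.I_sq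

theorem norm_sq_combination_le {x₁ x₂ x₃ x₄ : ℂ} :
    ‖x₁ + Complex.I * x₂ - (1 + Complex.I) / 2 * x₃ - (1 + Complex.I) / 2 * x₄‖ ^ 2
      ≤ 4 * (‖x₁‖ ^ 2 + ‖x₂‖ ^ 2 + ‖x₃‖ ^ 2 + ‖x₄‖ ^ 2) := by
  have hI : ‖(1 + Complex.I) / 2‖ ≤ 1 := by
    have := norm_add_le (1 : ℂ) Complex.I
    rw [norm_div, div_le_one (by simp)]
    refine this.trans ?_
    norm_num
  have h1 : ‖x₁ + Complex.I * x₂ - (1 + Complex.I) / 2 * x₃ - (1 + Complex.I) / 2 * x₄‖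
      ≤ ‖x₁‖ + ‖x₂‖ + ‖x₃‖ + ‖x₄‖ := by
    refine (norm_sub_le _ _).trans (add_le_add ((norm_sub_le _ _).trans
      (add_le_add ((norm_add_le _ _).trans (add_le_add le_rfl ?_)) ?_)) ?_)
    · rw [norm_mul, Complex.norm_I, one_mul]
    · rw [norm_mul]; exact mul_le_of_le_one_left (norm_nonneg _) hI
    · rw [norm_mul]; exact mul_le_of_le_one_left (norm_nonneg _) hI
  refine (pow_le_pow_left₀ (norm_nonneg _) h1 2).trans ?_
  nlinarith [sq_nonneg (‖x₁‖ - ‖x₂‖), sq_nonneg (‖x₁‖ - ‖x₃‖), sq_nonneg (‖x₁‖ - ‖x₄‖),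
    sq_nonneg (‖x₂‖ - ‖x₃‖), sq_nonneg (‖x₂‖ - ‖x₄‖), sq_nonneg (‖x₃‖ - ‖x₄‖)]

/-- The combination of the errors `R` of the output states in the estimate of `ε(|1⟩⟨k|)`. -/
def channelBound (R : Probe d → ℝ) (k : Fin d) : ℝ :=
  if h : k ≠ 0 then
    4 * (R (Sum.inr (Sum.inl ⟨k, h⟩)) + R (Sum.inr (Sum.inr ⟨k, h⟩)) + R (Sum.inl 0)
      + R (Sum.inl k))
  else R (Sum.inl 0)

theorem sum_norm_sq_channelEst_sub_le {ω : Record d n sel} {R : Probe d → ℝ} {a : Fin d}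
    (hR : ∀ x, ∑ q, ‖stateEst (ω x) a q - proj (outKet U x) a q‖ ^ 2 ≤ R x) (k : Fin d) :
    ∑ q, ‖channelEst ω k a q - U a 0 * star (U q k)‖ ^ 2 ≤ channelBound R k := by
  by_cases h : k ≠ 0
  · rw [channelBound, dif_pos h]
    refine le_trans ?_ (mul_le_mul_of_nonneg_left (add_le_add (add_le_add (add_le_add
      (hR (Sum.inr (Sum.inl ⟨k, h⟩))) (hR (Sum.inr (Sum.inr ⟨k, h⟩)))) (hR (Sum.inl 0)))
      (hR (Sum.inl k))) (by norm_num))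
    rw [← Finset.sum_add_distrib, ← Finset.sum_add_distrib, ← Finset.sum_add_distrib,
      Finset.mul_sum]
    refine Finset.sum_le_sum fun q _ => ?_
    refine le_trans (le_of_eq ?_) norm_sq_combination_le
    congr 2
    rw [← proj_outKet_combination U ⟨k, h⟩ a q, channelEst, dif_pos h]
    simp only [Matrix.sub_apply, Matrix.add_apply, Matrix.smul_apply, smul_eq_mul]
    ring
  · rw [channelBound, dif_neg h]
    refine le_trans (le_of_eq ?_) (hR (Sum.inl 0))
    refine Finset.sum_congr rfl fun q _ => ?_
    rw [proj_outKet_ket, channelEst, dif_neg h, not_not.1 h]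

/-! ### The expected error -/

theorem recordProb_eq (U : Mat d) (ω : Record d n sel) :
    recordProb U ω = ∏ x, stateProb (proj (outKet U x)) (ω x) := by
  simp only [recordProb, outState_eq]

theorem recordProb_nonneg (hU : U ∈ Matrix.unitaryGroup (Fin d) ℂ) (ω : Record d n sel) :
    0 ≤ recordProb U ω := by
  rw [recordProb_eq]
  exact Finset.prod_nonneg fun x _ => stateProb_nonneg (sum_norm_sq_outKet hU x) _

theorem expect_one (hU : U ∈ Matrix.unitaryGroup (Fin d) ℂ) :
    expect U (fun _ : Record d n sel => 1) = 1 := by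
  simp only [expect, recordProb_eq, mul_one]
  rw [sum_pi_prod (fun x (r : StateRecord d n (sel x)) => stateProb (proj (outKet U x)) r)]
  exact Finset.prod_eq_one fun x _ => sum_stateProb (sum_norm_sq_outKet hU x)

theorem expect_mono (hU : U ∈ Matrix.unitaryGroup (Fin d) ℂ) {f g : Record d n sel → ℝ}
    (h : ∀ ω, f ω ≤ g ω) : expect U f ≤ expect U g :=
  Finset.sum_le_sum fun ω _ => mul_le_mul_of_nonneg_left (h ω) (recordProb_nonneg hU ω)

theorem expect_add (f g : Record d n sel → ℝ) :
    expect U (fun ω => f ω + g ω) = expect U f + expect U g := by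
  simp only [expect, mul_add, Finset.sum_add_distrib]

theorem expect_const_mul (c : ℝ) (f : Record d n sel → ℝ) :
    expect U (fun ω => c * f ω) = c * expect U f := by
  simp only [expect, Finset.mul_sum]
  exact Finset.sum_congr rfl fun ω _ => by ring

theorem expect_sum {ι : Type*} (s : Finset ι) (f : ι → Record d n sel → ℝ) :
    expect U (fun ω => ∑ i ∈ s, f i ω) = ∑ i ∈ s, expect U (f i) := by
  simp only [expect, Finset.mul_sum]
  exact Finset.sum_comm

theorem expect_const (hU : U ∈ Matrix.unitaryGroup (Fin d) ℂ) (c : ℝ) :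
    expect U (fun _ : Record d n sel => c) = c := by
  have := expect_const_mul (U := U) c (fun _ : Record d n sel => 1)
  rwa [expect_one hU, mul_one] at this

theorem expect_coord (hU : U ∈ Matrix.unitaryGroup (Fin d) ℂ) (x : Probe d)
    (h : StateRecord d n (sel x) → ℝ) :
    expect U (fun ω : Record d n sel => h (ω x))
      = ∑ r, stateProb (proj (outKet U x)) r * h r := by
  simp only [expect, recordProb_eq]
  exact sum_pi_prod_mul (fun x (r : StateRecord d n (sel x)) => stateProb (proj (outKet U x)) r)
    (fun x => sum_stateProb (sum_norm_sq_outKet hU x)) x h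

/-- The factor 16 comes from four states, each with weight 4 from the square of a sum of four terms.
-/
theorem expect_channelBound_le (R : Record d n sel → Probe d → ℝ) {B : ℝ} (hB : 0 ≤ B)
    (hR : ∀ x, expect U (fun ω => R ω x) ≤ B) (k : Fin d) :
    expect U (fun ω => channelBound (R ω) k) ≤ 16 * B := by
  by_cases h : k ≠ 0
  · simp only [channelBound, dif_pos h]
    rw [expect_const_mul, expect_add, expect_add, expect_add]
    linarith [hR (Sum.inr (Sum.inl ⟨k, h⟩)), hR (Sum.inr (Sum.inr ⟨k, h⟩)), hR (Sum.inl 0),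
      hR (Sum.inl k)]
  · simp only [channelBound, dif_neg h]
    linarith [hR (Sum.inl 0)]

/-- This is Jensen's inequality in the linearized form f ≤ b/2 + f²/(2b). -/
theorem expect_le_of_expect_sq_le (hU : U ∈ Matrix.unitaryGroup (Fin d) ℂ)
    {f : Record d n sel → ℝ} {b : ℝ} (hb : 0 < b) (h : expect U (fun ω => f ω ^ 2) ≤ b ^ 2) :
    expect U f ≤ b := by
  have h1 : expect U f ≤ expect U fun ω => b / 2 + 1 / (2 * b) * f ω ^ 2 := by
    refine expect_mono hU fun ω => ?_
    have : b / 2 + 1 / (2 * b) * f ω ^ 2 - f ω = (f ω - b) ^ 2 / (2 * b) := by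
      field_simp; ring
    have : 0 ≤ (f ω - b) ^ 2 / (2 * b) := by positivity
    linarith
  rw [expect_add, expect_const hU, expect_const_mul] at h1
  have h2 : 1 / (2 * b) * expect U (fun ω => f ω ^ 2) ≤ 1 / (2 * b) * b ^ 2 := by gcongr
  have h3 : 1 / (2 * b) * b ^ 2 = b / 2 := by field_simp
  linarith

/-- The mean square error of the estimated gate. -/
theorem expect_norm_sq_gateEst_sub_le (hn : 0 < n) (hU : U ∈ Matrix.unitaryGroup (Fin d) ℂ)
    (hsel : ∀ (x : Probe d) (f : Fin d → ℝ) (k : Fin d), f k ≤ f (sel x f))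
    {jhat : Record d n sel → Fin d} {Ghat : Record d n sel → Mat d}
    (h : ∀ ω, IsReconstruction ω (jhat ω) (Ghat ω)) :
    expect U (fun ω => ‖gateEst U (jhat ω) (Ghat ω) - U‖ ^ 2) ≤ 27648000 * (d ^ 3 / n) := by
  have hn' : (0 : ℝ) < n := by positivity
  have hd : (0 : ℝ) < d := by exact_mod_cast Nat.pos_of_ne_zero (NeZero.ne d)
  have hm : ∀ x : Probe d, ∃ m, ∀ j, ‖outKet U x j‖ ^ 2 ≤ ‖outKet U x m‖ ^ 2 := fun x =>
    Finite.exists_max fun j => ‖outKet U x j‖ ^ 2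
  choose m hm using hm
  let R : Record d n sel → Probe d → ℝ := fun ω x => rowBound (outKet U x) (m x) (ω x)
  have hW : ∀ (ω : Record d n sel) a, ∑ k, ∑ q, ‖channelEst ω k a q - U a 0 * star (U q k)‖ ^ 2
      ≤ ∑ k, channelBound (R ω) k := fun ω a =>
    Finset.sum_le_sum fun k _ => sum_norm_sq_channelEst_sub_le (fun x =>
      sum_norm_sq_stateEst_sub_le (sum_norm_sq_outKet hU x) (hsel x) (hm x) (ω x) a) k
  have key := fun ω => norm_sq_gateEst_sub_le hU (hW ω) (h ω)
  -- For n < d² the trivial bound 4d is already at most 4d³/n.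
  by_cases hdn : d ^ 2 ≤ n
  · refine (expect_mono hU fun ω => (key ω).1).trans ?_
    rw [expect_const_mul, expect_const_mul, expect_sum]
    have h1 : ∀ k, expect U (fun ω : Record d n sel => channelBound (R ω) k)
        ≤ 16 * (27000 * d / n) := by
      refine expect_channelBound_le R (by positivity) fun x => ?_
      rw [expect_coord hU x (fun r => rowBound (outKet U x) (m x) r)]
      exact sum_stateProb_mul_rowBound_le (sum_norm_sq_outKet hU x) hn hdn (hm x)
    have h2 := Finset.sum_le_sum fun k (_ : k ∈ (Finset.univ : Finset (Fin d))) => h1 k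
    rw [Finset.sum_const, Finset.card_univ, Fintype.card_fin, nsmul_eq_mul] at h2
    calc _ ≤ 64 * (d * (d * (16 * (27000 * d / n) : ℝ))) := by gcongr
      _ = _ := by ring
  · refine (expect_mono hU fun ω => (key ω).2).trans ?_
    rw [expect_const hU]
    have h1 : (n : ℝ) ≤ d ^ 2 := by exact_mod_cast (not_le.1 hdn).le
    have h2 : (d : ℝ) ≤ d ^ 3 / n := by
      rw [le_div_iff₀ hn']
      nlinarith
    linarith

end Channel

end GateIdent

end

/-! ### From the mean square error to the total number of copies -/

theorem theorem1 :
    ∃ C : ℝ, 0 < C ∧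
      ∀ (d n : ℕ) [NeZero d], 0 < n →
      ∀ U ∈ Matrix.unitaryGroup (Fin d) ℂ,
      ∀ sel : GateIdent.Probe d → (Fin d → ℝ) → Fin d, (∀ (x : GateIdent.Probe d) (f : Fin d → ℝ) (k : Fin d), f k ≤ f (sel x f)) →
      ∀ (jhat : GateIdent.Record d n sel → Fin d) (Ghat : GateIdent.Record d n sel → GateIdent.Mat d),
        (∀ ω, GateIdent.IsReconstruction ω (jhat ω) (Ghat ω)) →
        GateIdent.expect U (fun ω => ‖GateIdent.gateEst U (jhat ω) (Ghat ω) - U‖)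
          ≤ C * ((d : ℝ) ^ (5 / 2 : ℝ) / √(GateIdent.totalCopies d n : ℝ)) := by
  -- The square of the constant must be at least 6 · 27648000, where 6 comes from N ≤ 6d²n and
  -- 27648000 from the mean square error.
  refine ⟨13000, by norm_num, fun d n _ hn U hU sel hsel jhat Ghat h => ?_⟩
  have hd1 : 1 ≤ d := Nat.pos_of_ne_zero (NeZero.ne d)
  have hd : (0 : ℝ) < d := by exact_mod_cast hd1
  have hn' : (0 : ℝ) < n := by exact_mod_cast hn
  have hN0 : 0 < GateIdent.totalCopies d n :=
    Nat.mul_pos (by omega) (Nat.mul_pos (by omega) hn)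
  have hN0' : (0 : ℝ) < GateIdent.totalCopies d n := by exact_mod_cast hN0
  have hN : (GateIdent.totalCopies d n : ℝ) ≤ 6 * d ^ 2 * n := by
    have h1 : GateIdent.totalCopies d n ≤ 3 * d * (2 * d * n) :=
      Nat.mul_le_mul (Nat.sub_le _ _) (Nat.mul_le_mul_right _ (Nat.sub_le _ _))
    have h2 : (GateIdent.totalCopies d n : ℝ) ≤ 3 * d * (2 * d * n) := by exact_mod_cast h1
    linarith
  refine GateIdent.expect_le_of_expect_sq_le hU (by positivity)
    ((GateIdent.expect_norm_sq_gateEst_sub_le hn hU hsel h).trans ?_)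
  have hpow : ((d : ℝ) ^ (5 / 2 : ℝ)) ^ 2 = d ^ 5 := by
    rw [← Real.rpow_natCast, ← Real.rpow_mul hd.le, ← Real.rpow_natCast]
    norm_num
  rw [mul_pow, div_pow, hpow, Real.sq_sqrt hN0'.le]
  have h3 : (d : ℝ) ^ 5 / (6 * d ^ 2 * n) ≤ d ^ 5 / GateIdent.totalCopies d n := by gcongr
  have h4 : (d : ℝ) ^ 5 / (6 * d ^ 2 * n) = 1 / 6 * (d ^ 3 / n) := by field_simp
  have h5 : (0 : ℝ) ≤ d ^ 3 / n := by positivity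
  rw [h4] at h3
  linarith
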